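/- **Theorem (Control of the acceptance ratio).** Setting. For a forward process $\mathrm dX_t=f_tX_t\,\mathrm dt+g_t\,\mathrm dB_t$ on $\mathbb R^d$ put $\alpha_t=\exp\big(\int_0^t f_u\,\mathrm du\big)$ and $\sigma_t=\alpha_t\big(\int_0^t g_u^2\alpha_u^{-2}\,\mathrm du\big)^{1/2}$, so that $X_t$ has the law of $\alpha_tX_0+\sigma_tZ$ with $Z\sim\mathcal N(0,\mathrm{Id})$ independent of $X_0$ (for $f_t=-1/(1-t)$, $g_t^2=2t/(1-t)$ this gives $\alpha_t=1-t$, $\sigma_t=t$). If $X_0$ has density $r$, denote by $r_t(x)=\int r(x_0)\,\mathcal N(x;\alpha_tx_0,\sigma_t^2\mathrm{Id})\,\mathrm dx_0$ the density of $X_t$ and by $r_{0|t}(x_0|x)=r(x_0)\,\mathcal N(x;\alpha_tx_0,\sigma_t^2\mathrm{Id})/r_t(x)$ the posterior density. The score $\nabla\log r$ is taken to be $0$ where $r=0$. For densities $r,r'$ let $$\mathrm{FI}(r|r')=\int\|\nabla\log r-\nabla\log r'\|^2\,r\,\mathrm dx,\qquad \chi_k(r|r')=\int\Big|1-\frac{r}{r'}\Big|^k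 r'\,\mathrm dx\in[0,\infty],$$ with $\chi_k(r|r')=+\infty$ if $r$ is not absolutely continuous with respect to $r'$. Let $q=q_{\rm data}$ (target model) and $p=p_{\rm data}$ (draft model) be $C^1$ probability densities on $\mathbb R^d$, and let $$\mathrm D(p,q)=\mathrm{FI}(q|p)+\chi_{16}(p|q)^{1/8}+\chi_{16}(q|p)^{1/8}\in[0,\infty].$$ Let $N\ge1$, $\gamma=1/N$, $0\le n<N$, $t_n=n\gamma$, $s=1-t_n$, $\varepsilon>0$; let $f,g$ be continuous on $[0,s]$ with $\sigma_s>0$. One Euler--Maruyama step of the backward process with churn parameter $\varepsilon$ and exact score for the data density $r\in\{p,q\}$ goes from $y$ to a Gaussian with mean $m^r(y)=y+\gamma\big(-f_sy+\tfrac{1+\varepsilon^2}{2}g_s^2\nabla\log r_s(y)\big)$ and covariance $\gamma\varepsilon^2g_s^2\,\mathrm{Id}$. Let $Y\sim q_s$ and $Z\sim\mathcal N(0,\mathrm{Id})$ be independent, $\Delta=(m^p(Y)-m^q(Y))/(\sqrt\gamma\,\varepsilon g_s)$ (and $\Delta=0$ if $g_s=0$), and let $a_n=\varphi(Z+\Delta)/\varphi(Z)$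 be the acceptance ratio, where $\varphi$ is the standard Gaussian density. Assumptions. For some $M<\infty$: 1. $\int\|x\|^4p(x)\,\mathrm dx\le M$ and $\int\|x\|^4q(x)\,\mathrm dx\le M$; 2. $\int\|\nabla\log p\|^4\,q\,\mathrm dx\le M$ and $\int\|\nabla\log q\|^4\,q\,\mathrm dx\le M$; 3. $\chi_2(q|p)\le M$, and $\chi_8(p|q)\le M$ unless $\chi_8(p|q)=\infty$ (in which case $\mathrm D(p,q)=\infty$); 4. $\int\|\nabla\log r(x_0)\|\,r_{0|s}(x_0|x)\,\mathrm dx_0<\infty$ for all $x\in\mathbb R^d$ and $r\in\{p,q\}$. Conclusion. There is a constant $C\ge0$ depending only on $d$ and $M$ (not on $p,q,f,g,\varepsilon,N,n$) such that $\log a_n$ and $a_n$ are integrable and, with $$B=C\,\gamma\,g_s^2\,\big(\varepsilon+\tfrac1\varepsilon\big)^2\min\Big(\big(\tfrac1{\sigma_s}-\sigma_s\big)^2+\alpha_s^2,\ \tfrac1{\alpha_s^2}\,\mathrm D(p,q)\Big),$$ one has $$\mathbb E[\log a_n]\ge -B\qquad\text{and}\qquad \mathbb E[a_n]\ge\exp(-B).$$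 -/

import Mathlib

open MeasureTheory ProbabilityTheory
open scoped ENNReal NNReal

namespace SpecDiffusion

noncomputable section

/-- Density at `x` of the Gaussian law `N(m, σ² Id)` on `ℝᵈ`. -/
def gaussDensity {d : ℕ} (m : EuclideanSpace ℝ (Fin d)) (σ : ℝ)
    (x : EuclideanSpace ℝ (Fin d)) : ℝ :=
  (2 * Real.pi * σ ^ 2) ^ (-(d : ℝ) / 2) * Real.exp (-‖x - m‖ ^ 2 / (2 * σ ^ 2))

/-- A continuously differentiable probability density on `ℝᵈ`. -/
structure IsC1Density {d : ℕ} (p : EuclideanSpace ℝ (Fin d) → ℝ) : Prop where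
  nonneg : ∀ x, 0 ≤ p x
  contDiff : ContDiff ℝ 1 p
  lintegral_eq_one : ∫⁻ x, ENNReal.ofReal (p x) = 1

/-- The Stein score `∇ log p`. For a nonnegative `C¹` function it is `∇p / p` where `p > 0`;
where `p = 0` it is `0` (there `log p` is either not differentiable or locally constant in Lean). -/
def score {d : ℕ} (p : EuclideanSpace ℝ (Fin d) → ℝ) (x : EuclideanSpace ℝ (Fin d)) :
    EuclideanSpace ℝ (Fin d) :=
  gradient (fun y => Real.log (p y)) x

/-- `α_t = exp (∫₀ᵗ f)`: the mean coefficient of `dX = f X dt + g dB`. -/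
def alphaCoef (f : ℝ → ℝ) (t : ℝ) : ℝ :=
  Real.exp (∫ u in (0 : ℝ)..t, f u)

/-- `σ_t = α_t (∫₀ᵗ g² / α²)^{1/2}`: the noise level of `dX = f X dt + g dB`, so that
`X_t` has the law of `α_t X_0 + σ_t Z`, with `Z` standard Gaussian independent of `X_0`. -/
def sigmaCoef (f g : ℝ → ℝ) (t : ℝ) : ℝ :=
  alphaCoef f t * Real.sqrt (∫ u in (0 : ℝ)..t, g u ^ 2 / alphaCoef f u ^ 2)

/-- Density `p_t` of `X_t`, for the forward process started from the density `p`. -/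
def marginal {d : ℕ} (f g : ℝ → ℝ) (p : EuclideanSpace ℝ (Fin d) → ℝ) (t : ℝ)
    (x : EuclideanSpace ℝ (Fin d)) : ℝ :=
  ∫ x₀, p x₀ * gaussDensity (alphaCoef f t • x₀) (sigmaCoef f g t) x

/-- Conditional density `p_{0|t}(x₀ | x)` of `X_0` given `X_t = x`. -/
def posterior {d : ℕ} (f g : ℝ → ℝ) (p : EuclideanSpace ℝ (Fin d) → ℝ) (t : ℝ)
    (x₀ x : EuclideanSpace ℝ (Fin d)) : ℝ :=
  p x₀ * gaussDensity (alphaCoef f t • x₀) (sigmaCoef f g t) x / marginal f g p t x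

/-- Fisher divergence `FI(p | q) = ∫ ‖∇ log p - ∇ log q‖² p`. -/
def fisherDiv {d : ℕ} (p q : EuclideanSpace ℝ (Fin d) → ℝ) : ℝ≥0∞ :=
  ∫⁻ x, ‖score p x - score q x‖ₑ ^ 2 * ENNReal.ofReal (p x)

/-- The divergence `χ_k(p | q) = ∫ |1 - p/q|^k q` (for `k ≥ 2`), with the usual convention for
divergences: it is infinite if the law `p` is not absolutely continuous with respect to `q`. -/
def chiDiv {d : ℕ} (k : ℕ) (p q : EuclideanSpace ℝ (Fin d) → ℝ) : ℝ≥0∞ :=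
  ∫⁻ x, if q x = 0 then (if p x = 0 then 0 else ⊤)
    else ENNReal.ofReal (|1 - p x / q x| ^ k * q x)

/-- The divergence between the target data density `q` and the draft data density `p`. -/
def dataDiv {d : ℕ} (p q : EuclideanSpace ℝ (Fin d) → ℝ) : ℝ≥0∞ :=
  fisherDiv q p + chiDiv 16 p q ^ (1 / 8 : ℝ) + chiDiv 16 q p ^ (1 / 8 : ℝ)

/-- Drift of the backward process with churn `ε`, for the data density `p`, at the forward
time `s`: `-f_s y + (1 + ε²)/2 g_s² ∇ log p_s(y)`. -/
def backwardDrift {d : ℕ} (f g : ℝ → ℝ) (ε : ℝ) (p : EuclideanSpace ℝ (Fin d) → ℝ) (s : ℝ)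
    (y : EuclideanSpace ℝ (Fin d)) : EuclideanSpace ℝ (Fin d) :=
  -(f s • y) + ((1 + ε ^ 2) / 2 * g s ^ 2) • score (marginal f g p s) y

/-- Mean of one Euler--Maruyama step of size `γ` from `y`. -/
def stepMean {d : ℕ} (f g : ℝ → ℝ) (ε γ : ℝ) (p : EuclideanSpace ℝ (Fin d) → ℝ) (s : ℝ)
    (y : EuclideanSpace ℝ (Fin d)) : EuclideanSpace ℝ (Fin d) :=
  y + γ • backwardDrift f g ε p s y

/-- Standard deviation `√γ ε g_s` of one Euler--Maruyama step of size `γ`. -/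
def stepStd (g : ℝ → ℝ) (ε γ s : ℝ) : ℝ :=
  Real.sqrt γ * ε * g s

/-- Normalised difference `Δ` between the means of the draft step (data density `p`) and of the
target step (data density `q`), both from `y`. -/
def meanGap {d : ℕ} (f g : ℝ → ℝ) (ε γ : ℝ) (p q : EuclideanSpace ℝ (Fin d) → ℝ) (s : ℝ)
    (y : EuclideanSpace ℝ (Fin d)) : EuclideanSpace ℝ (Fin d) :=
  (stepStd g ε γ s)⁻¹ • (stepMean f g ε γ p s y - stepMean f g ε γ q s y)

/-- Acceptance ratio `φ(z + Δ) / φ(z)`, with `φ` the standard Gaussian density, of the draft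
state proposed from `y` with noise `z`. -/
def acceptRatio {d : ℕ} (f g : ℝ → ℝ) (ε γ : ℝ) (p q : EuclideanSpace ℝ (Fin d) → ℝ) (s : ℝ)
    (y z : EuclideanSpace ℝ (Fin d)) : ℝ :=
  gaussDensity 0 1 (z + meanGap f g ε γ p q s y) / gaussDensity 0 1 z

/-- `min ((1/σ_s - σ_s)² + α_s², D(p, q) / α_s²)`. -/
def minFactor {d : ℕ} (f g : ℝ → ℝ) (p q : EuclideanSpace ℝ (Fin d) → ℝ) (s : ℝ) : ℝ :=
  (min (ENNReal.ofReal ((1 / sigmaCoef f g s - sigmaCoef f g s) ^ 2 + alphaCoef f s ^ 2))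
    (dataDiv p q / ENNReal.ofReal (alphaCoef f s ^ 2))).toReal

end

end SpecDiffusion

/-! The ratio equals `exp (-(⟪Z, Δ⟫ + ‖Δ‖² / 2))`, where `Δ` is a function of `Y` and `Z` is an
independent standard Gaussian. Hence `E[a] = 1` exactly, so the bound on `E[a]` only needs `B ≥ 0`,
while `E[log a] = -E‖Δ‖² / 2`. Since `‖Δ‖² = γ g² (ε + 1/ε)² / 4 * ‖∇log p_s - ∇log q_s‖²`,
everything reduces to bounding the squared distance of the two noised scores in `L²(q_s)` by a
constant times each entry of the minimum.

Both bounds write a noised score as a posterior mean. By Tweedie's formula, `∇log p_s(x)` is the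
mean of `(α x₀ - x) / σ²` given `x`. Estimating each score separately gives order `1/σ²`. In the
difference `x` cancels, and fourth moments of the data give order `α²/σ⁴`. The second estimate is
used for `σ` in `[1/2, 2]`, the first elsewhere; this is `lintegral_score_sub_sq_le_first`.

Integration by parts also shows that `α ∇log p_s(x)` is the posterior mean of `∇log p(x₀)`. The
difference for `p` and `q` splits into the `q`-posterior mean of `∇log p - ∇log q`, controlled by
the Fisher divergence through Jensen, and the effect on `∇log p` of exchanging the posteriors. The
quotient of the posteriors is `(p/q) * (q_s/p_s)`, and `q_s/p_s` is the `p`-posterior mean of `q/p`,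
so its distance to `1` is controlled by `1 - p/q` and `1 - q/p`. Cauchy-Schwarz and Jensen turn this
into the `χ₁₆` terms. The perturbation argument needs bounded moments of `q/p`, hence `χ₁₆(q|p) ≤
1`; otherwise a crude triangle inequality suffices. This is `lintegral_score_sub_sq_le_second`.

Averages under `q_s` of `p`-posterior means are handled for an abstract channel in `IsChannel`,
where only Cauchy-Schwarz, Jensen and Bayes' formula matter. -/

namespace SpecDiffusion

/-! ### Elementary inequalities for extended nonnegative integrals -/

section Inequalities

variable {α : Type*} [MeasurableSpace α] {μ : Measure α}

lemma sq_lintegral_mul_le {f g : α → ℝ≥0∞} (hf : AEMeasurable f μ) (hg : AEMeasurable g μ) :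
    (∫⁻ a, f a * g a ∂μ) ^ 2 ≤ (∫⁻ a, f a ^ 2 ∂μ) * ∫⁻ a, g a ^ 2 ∂μ := by
  have h := ENNReal.lintegral_mul_le_Lp_mul_Lq μ Real.HolderConjugate.two_two hf hg
  calc (∫⁻ a, f a * g a ∂μ) ^ 2
      ≤ ((∫⁻ a, f a ^ (2 : ℝ) ∂μ) ^ (1 / 2 : ℝ) * (∫⁻ a, g a ^ (2 : ℝ) ∂μ) ^ (1 / 2 : ℝ)) ^ 2 := by
        gcongr
        exact h
    _ = _ := by
        rw [mul_pow, ← ENNReal.rpow_natCast, ← ENNReal.rpow_natCast, ← ENNReal.rpow_mul,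
          ← ENNReal.rpow_mul]
        norm_num

lemma lintegral_pow_le [IsProbabilityMeasure μ] {f : α → ℝ≥0∞} (hf : AEMeasurable f μ)
    {k : ℕ} (hk : 1 ≤ k) : (∫⁻ a, f a ∂μ) ^ k ≤ ∫⁻ a, f a ^ k ∂μ := by
  -- The exponent `1` is separated because its Hölder conjugate would be infinite.
  rcases hk.eq_or_lt with rfl | hk
  · simp
  have hk' : (1 : ℝ) < k := by exact_mod_cast hk
  have h := ENNReal.lintegral_mul_le_Lp_mul_Lq μ (Real.HolderConjugate.conjExponent hk') hf
    (aemeasurable_const (b := (1 : ℝ≥0∞)))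
  simp only [Pi.mul_apply, mul_one, ENNReal.one_rpow, lintegral_const, measure_univ] at h
  calc (∫⁻ a, f a ∂μ) ^ k ≤ ((∫⁻ a, f a ^ (k : ℝ) ∂μ) ^ (1 / (k : ℝ))) ^ k := by
        gcongr
    _ = _ := by
        rw [← ENNReal.rpow_natCast, ← ENNReal.rpow_mul, one_div_mul_cancel (by positivity)]
        simp

lemma two_mul_le_sq_add_sq (x y : ℝ≥0∞) : 2 * x * y ≤ x ^ 2 + y ^ 2 := by
  rcases eq_or_ne x ⊤ with rfl | hx
  · simp
  rcases eq_or_ne y ⊤ with rfl | hy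
  · simp
  lift x to ℝ≥0 using hx
  lift y to ℝ≥0 using hy
  norm_cast
  exact _root_.two_mul_le_add_sq x y

lemma add_sq_le_two_mul (x y : ℝ≥0∞) : (x + y) ^ 2 ≤ 2 * (x ^ 2 + y ^ 2) := by
  calc (x + y) ^ 2 = x ^ 2 + y ^ 2 + 2 * x * y := by ring
    _ ≤ x ^ 2 + y ^ 2 + (x ^ 2 + y ^ 2) := by gcongr; exact two_mul_le_sq_add_sq x y
    _ = _ := by ring

lemma sq_add_sq_le (x y : ℝ≥0∞) : x ^ 2 + y ^ 2 ≤ (x + y) ^ 2 := by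
  calc x ^ 2 + y ^ 2 ≤ x ^ 2 + y ^ 2 + 2 * x * y := le_self_add
    _ = _ := by ring

lemma one_add_pow_le {j k : ℕ} (hjk : j ≤ k) (x : ℝ≥0∞) : (1 + x) ^ j ≤ 2 ^ k * (1 + x ^ k) := by
  calc (1 + x) ^ j ≤ (1 + x) ^ k := pow_le_pow_right₀ le_self_add hjk
    _ ≤ (2 * max 1 x) ^ k := by
        gcongr
        rw [two_mul]
        gcongr
        · exact le_max_left _ _
        · exact le_max_right _ _
    _ = 2 ^ k * (max 1 x) ^ k := mul_pow _ _ _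
    _ ≤ 2 ^ k * (1 + x ^ k) := by
        gcongr
        rcases le_total 1 x with h | h
        · simp [h]
        · simp [h]

end Inequalities

/-! ### Bayes' formula and change of prior for an abstract channel -/

section Channel

variable {α β : Type*} [MeasurableSpace α] [MeasurableSpace β]

/-- A family of positive, bounded probability densities `b ↦ G a b` with respect to `ν`. -/
structure IsChannel (G : α → β → ℝ≥0∞) (ν : Measure β) : Prop where
  measurable : Measurable (Function.uncurry G)
  lintegral_eq_one : ∀ a, ∫⁻ b, G a b ∂ν = 1
  pos : ∀ a b, G a b ≠ 0
  bdd : ∃ K : ℝ≥0, ∀ a b, G a b ≤ K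

/-- Density of the output of the channel `G` with input law `μ`. -/
noncomputable def mix (G : α → β → ℝ≥0∞) (μ : Measure α) (b : β) : ℝ≥0∞ := ∫⁻ a, G a b ∂μ

/-- Posterior law of the input of the channel `G` with prior `μ`, given the output `b`. -/
noncomputable def post (G : α → β → ℝ≥0∞) (μ : Measure α) (b : β) : Measure α :=
  (mix G μ b)⁻¹ • μ.withDensity (fun a => G a b)

/-- Law of the output of the channel `G` with input law `μ`. -/
noncomputable def outLaw (G : α → β → ℝ≥0∞) (ν : Measure β) (μ : Measure α) : Measure β :=
  ν.withDensity (mix G μ)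

/-- Joint law of the input and the output of the channel `G` with input law `μ`. -/
noncomputable def jointLaw (G : α → β → ℝ≥0∞) (ν : Measure β) (μ : Measure α) :
    Measure (α × β) :=
  (μ.prod ν).withDensity (Function.uncurry G)

variable {G : α → β → ℝ≥0∞} {ν : Measure β} {μ : Measure α}

namespace IsChannel

lemma measurable_left (hG : IsChannel G ν) (b : β) : Measurable (fun a => G a b) :=
  hG.measurable.comp (measurable_id.prodMk measurable_const)

lemma measurable_mix (hG : IsChannel G ν) [SFinite μ] : Measurable (mix G μ) :=
  hG.measurable.lintegral_prod_left'

lemma mix_ne_zero (hG : IsChannel G ν) [IsProbabilityMeasure μ] (b : β) : mix G μ b ≠ 0 := by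
  intro h
  rw [mix, lintegral_eq_zero_iff (hG.measurable_left b)] at h
  have : ∀ᵐ _ ∂μ, False := h.mono fun a ha => hG.pos a b ha
  exact IsProbabilityMeasure.ne_zero μ (by simpa using this)

lemma mix_ne_top (hG : IsChannel G ν) [IsProbabilityMeasure μ] (b : β) : mix G μ b ≠ ⊤ := by
  obtain ⟨K, hK⟩ := hG.bdd
  refine ((lintegral_mono fun a => hK a b).trans_lt ?_).ne
  simp

/-- Bayes' formula with the denominator cleared. Positivity and boundedness of `G` keep `mix` away
from `0` and `⊤` at every output, so there is no exceptional null set, and finiteness of `G` removes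
any measurability condition on `F`. -/
lemma lintegral_post_mul_mix (hG : IsChannel G ν) [IsProbabilityMeasure μ] (b : β)
    (F : α → ℝ≥0∞) : (∫⁻ a, F a ∂post G μ b) * mix G μ b = ∫⁻ a, G a b * F a ∂μ := by
  obtain ⟨K, hK⟩ := hG.bdd
  rw [post, lintegral_smul_measure, lintegral_withDensity_eq_lintegral_mul_non_measurable _
    (hG.measurable_left b) (ae_of_all _ fun a => (hK a b).trans_lt (by simp)), smul_eq_mul,
    mul_comm, ← mul_assoc, ENNReal.mul_inv_cancel (hG.mix_ne_zero b) (hG.mix_ne_top b), one_mul]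
  rfl

lemma isProbabilityMeasure_post (hG : IsChannel G ν) [IsProbabilityMeasure μ] (b : β) :
    IsProbabilityMeasure (post G μ b) := by
  refine ⟨?_⟩
  have h := hG.lintegral_post_mul_mix (μ := μ) b (fun _ => 1)
  simp only [lintegral_one, mul_one] at h
  rw [← ENNReal.mul_left_inj (hG.mix_ne_zero (μ := μ) b) (hG.mix_ne_top b), h, one_mul, mix]

lemma measurable_lintegral_post (hG : IsChannel G ν) [IsProbabilityMeasure μ]
    {F : α × β → ℝ≥0∞} (hF : Measurable F) : Measurable fun b => ∫⁻ a, F (a, b) ∂post G μ b := by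
  have h : (fun b => ∫⁻ a, F (a, b) ∂post G μ b) =
      fun b => (∫⁻ a, G a b * F (a, b) ∂μ) / mix G μ b := by
    funext b
    rw [ENNReal.eq_div_iff (hG.mix_ne_zero b) (hG.mix_ne_top b), mul_comm,
      hG.lintegral_post_mul_mix]
  rw [h]
  refine Measurable.div ?_ hG.measurable_mix
  exact Measurable.lintegral_prod_left' (f := fun z : α × β => Function.uncurry G z * F z)
    (hG.measurable.mul hF)

lemma lintegral_outLaw (hG : IsChannel G ν) [IsProbabilityMeasure μ] (F : β → ℝ≥0∞) :
    ∫⁻ b, F b ∂outLaw G ν μ = ∫⁻ b, F b * mix G μ b ∂ν := by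
  rw [outLaw, lintegral_withDensity_eq_lintegral_mul_non_measurable _ hG.measurable_mix
    (ae_of_all _ fun b => (hG.mix_ne_top b).lt_top)]
  simp [mul_comm]

lemma lintegral_jointLaw [SFinite ν] (hG : IsChannel G ν) [IsProbabilityMeasure μ]
    {F : α × β → ℝ≥0∞} (hF : Measurable F) :
    ∫⁻ z, F z ∂jointLaw G ν μ = ∫⁻ b, ∫⁻ a, F (a, b) ∂post G μ b ∂outLaw G ν μ := by
  rw [hG.lintegral_outLaw, jointLaw, lintegral_withDensity_eq_lintegral_mul _ hG.measurable hF,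
    lintegral_prod_symm' _ (hG.measurable.mul hF)]
  simp_rw [hG.lintegral_post_mul_mix]
  rfl

lemma lintegral_jointLaw_fst [SFinite ν] (hG : IsChannel G ν) [IsProbabilityMeasure μ]
    {F : α → ℝ≥0∞} (hF : Measurable F) : ∫⁻ z, F z.1 ∂jointLaw G ν μ = ∫⁻ a, F a ∂μ := by
  rw [jointLaw, lintegral_withDensity_eq_lintegral_mul _ hG.measurable (by fun_prop),
    lintegral_prod _ (hG.measurable.mul (by fun_prop)).aemeasurable]
  refine lintegral_congr fun a => ?_
  simp only [Pi.mul_apply, Function.uncurry_apply_pair]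
  rw [lintegral_mul_const _ (f := fun b => G a b) (hG.measurable.comp measurable_prodMk_left), hG.lintegral_eq_one,
    one_mul]

lemma lintegral_jointLaw_snd [SFinite ν] (hG : IsChannel G ν) [IsProbabilityMeasure μ]
    {F : β → ℝ≥0∞} (hF : Measurable F) :
    ∫⁻ z, F z.2 ∂jointLaw G ν μ = ∫⁻ b, F b ∂outLaw G ν μ := by
  rw [hG.lintegral_jointLaw (by fun_prop)]
  refine lintegral_congr fun b => ?_
  have := hG.isProbabilityMeasure_post (μ := μ) b
  simp

lemma lintegral_post_outLaw [SFinite ν] (hG : IsChannel G ν) [IsProbabilityMeasure μ]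
    {F : α → ℝ≥0∞} (hF : Measurable F) :
    ∫⁻ b, ∫⁻ a, F a ∂post G μ b ∂outLaw G ν μ = ∫⁻ a, F a ∂μ := by
  rw [← hG.lintegral_jointLaw_fst hF, hG.lintegral_jointLaw (by fun_prop)]

/-- Jensen's inequality for the posterior law. -/
lemma lintegral_post_pow_le (hG : IsChannel G ν) [IsProbabilityMeasure μ]
    {F : α → ℝ≥0∞} (hF : Measurable F) {k : ℕ} (hk : 1 ≤ k) (b : β) :
    (∫⁻ a, F a ∂post G μ b) ^ k ≤ ∫⁻ a, F a ^ k ∂post G μ b := by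
  have := hG.isProbabilityMeasure_post (μ := μ) b
  exact lintegral_pow_le hF.aemeasurable hk

lemma lintegral_post_pow_outLaw_le [SFinite ν] (hG : IsChannel G ν) [IsProbabilityMeasure μ]
    {F : α × β → ℝ≥0∞} (hF : Measurable F) {k : ℕ} (hk : 1 ≤ k) :
    ∫⁻ b, (∫⁻ a, F (a, b) ∂post G μ b) ^ k ∂outLaw G ν μ ≤ ∫⁻ z, F z ^ k ∂jointLaw G ν μ := by
  rw [hG.lintegral_jointLaw (hF.pow_const k)]
  exact lintegral_mono fun b => hG.lintegral_post_pow_le (hF.comp measurable_prodMk_right) hk b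

/-- Conditional expectation contracts moments: Jensen inside the posterior, then the tower property.
-/
lemma lintegral_post_pow_outLaw_le_fst [SFinite ν] (hG : IsChannel G ν) [IsProbabilityMeasure μ]
    {F : α → ℝ≥0∞} (hF : Measurable F) {k : ℕ} (hk : 1 ≤ k) :
    ∫⁻ b, (∫⁻ a, F a ∂post G μ b) ^ k ∂outLaw G ν μ ≤ ∫⁻ a, F a ^ k ∂μ :=
  (hG.lintegral_post_pow_outLaw_le (hF.comp measurable_fst) hk).trans
    (hG.lintegral_jointLaw_fst (hF.pow_const k)).le

section ChangeOfPrior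

variable {u : α → ℝ≥0∞}

/-- Reweighting the prior by `u` multiplies the output density by the posterior mean of `u`. Every
later change from one output law to the other goes through this factor. -/
lemma mix_withDensity (hG : IsChannel G ν) [IsProbabilityMeasure μ] (hu : Measurable u) (b : β) :
    mix G (μ.withDensity u) b = (∫⁻ a, u a ∂post G μ b) * mix G μ b := by
  rw [hG.lintegral_post_mul_mix, mix,
    lintegral_withDensity_eq_lintegral_mul _ hu (hG.measurable_left b)]
  simp [mul_comm]

lemma lintegral_outLaw_withDensity (hG : IsChannel G ν) [IsProbabilityMeasure μ]
    (hu : Measurable u) [IsProbabilityMeasure (μ.withDensity u)] (F : β → ℝ≥0∞) :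
    ∫⁻ b, F b ∂outLaw G ν (μ.withDensity u) =
      ∫⁻ b, F b * ∫⁻ a, u a ∂post G μ b ∂outLaw G ν μ := by
  rw [hG.lintegral_outLaw, hG.lintegral_outLaw]
  simp_rw [hG.mix_withDensity hu, mul_assoc]

lemma jointLaw_withDensity [SFinite ν] (hG : IsChannel G ν) [IsProbabilityMeasure μ]
    (hu : Measurable u) :
    jointLaw G ν (μ.withDensity u) = (jointLaw G ν μ).withDensity (fun z => u z.1) := by
  have : (μ.withDensity u).prod ν = (μ.prod ν).withDensity (fun z => u z.1) :=
    prod_withDensity_left hu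
  rw [jointLaw, jointLaw, this, ← withDensity_mul _ (by fun_prop) hG.measurable,
    ← withDensity_mul _ hG.measurable (by fun_prop), mul_comm]

/-- Second moment of a posterior mean, under the output law of another prior. -/
lemma sq_lintegral_post_sq_le [SFinite ν] (hG : IsChannel G ν) [IsProbabilityMeasure μ]
    (hu : Measurable u) [IsProbabilityMeasure (μ.withDensity u)]
    {F : α × β → ℝ≥0∞} (hF : Measurable F) :
    (∫⁻ b, (∫⁻ a, F (a, b) ∂post G μ b) ^ 2 ∂outLaw G ν (μ.withDensity u)) ^ 2 ≤
      (∫⁻ a, u a ^ 2 ∂μ) * ∫⁻ z, F z ^ 4 ∂jointLaw G ν μ := by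
  rw [hG.lintegral_outLaw_withDensity hu]
  have hm := hG.measurable_lintegral_post (μ := μ) hF
  have hR := hG.measurable_lintegral_post (μ := μ) (hu.comp measurable_fst)
  -- Cauchy-Schwarz separates the posterior mean from the weight produced by the change of prior.
  refine (sq_lintegral_mul_le (hm.pow_const 2).aemeasurable hR.aemeasurable).trans ?_
  rw [mul_comm]
  refine mul_le_mul' (hG.lintegral_post_pow_outLaw_le_fst hu one_le_two) ?_
  simp_rw [← pow_mul]
  exact hG.lintegral_post_pow_outLaw_le hF (by norm_num)

/-- The change of output law contributes one more factor of the ratio itself, hence the exponent `k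
+ 1`. -/
lemma lintegral_ratio_pow_le [SFinite ν] (hG : IsChannel G ν) [IsProbabilityMeasure μ]
    (hu : Measurable u) [IsProbabilityMeasure (μ.withDensity u)] (k : ℕ) :
    ∫⁻ b, (∫⁻ a, u a ∂post G μ b) ^ k ∂outLaw G ν (μ.withDensity u) ≤ ∫⁻ a, u a ^ (k + 1) ∂μ := by
  rw [hG.lintegral_outLaw_withDensity hu]
  simp_rw [← pow_succ]
  exact hG.lintegral_post_pow_outLaw_le_fst hu (by omega)

lemma sq_lintegral_post_pow_le [SFinite ν] (hG : IsChannel G ν) [IsProbabilityMeasure μ]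
    (hu : Measurable u) [IsProbabilityMeasure (μ.withDensity u)]
    {v : α → ℝ≥0∞} (hv : Measurable v) {k : ℕ} (hk : 1 ≤ k) :
    (∫⁻ b, (∫⁻ a, v a ∂post G μ b) ^ k ∂outLaw G ν (μ.withDensity u)) ^ 2 ≤
      (∫⁻ a, v a ^ (2 * k) ∂μ) * ∫⁻ a, u a ^ 2 ∂μ := by
  rw [hG.lintegral_outLaw_withDensity hu]
  have hm := hG.measurable_lintegral_post (μ := μ) (hv.comp measurable_fst)
  have hR := hG.measurable_lintegral_post (μ := μ) (hu.comp measurable_fst)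
  refine (sq_lintegral_mul_le (hm.pow_const k).aemeasurable hR.aemeasurable).trans ?_
  refine mul_le_mul' ?_ (hG.lintegral_post_pow_outLaw_le_fst hu one_le_two)
  simp_rw [← pow_mul, mul_comm k 2]
  exact hG.lintegral_post_pow_outLaw_le_fst hv (by omega)

end ChangeOfPrior

end IsChannel

end Channel

end SpecDiffusion

/-! ### Moment bounds for posterior means under a perturbed prior -/

namespace SpecDiffusion

lemma add_pow_four_le (x y : ℝ≥0∞) : (x + y) ^ 4 ≤ 8 * (x ^ 4 + y ^ 4) := by
  calc (x + y) ^ 4 = ((x + y) ^ 2) ^ 2 := by ring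
    _ ≤ (2 * (x ^ 2 + y ^ 2)) ^ 2 := by gcongr; exact add_sq_le_two_mul x y
    _ = 4 * (x ^ 2 + y ^ 2) ^ 2 := by ring
    _ ≤ 4 * (2 * ((x ^ 2) ^ 2 + (y ^ 2) ^ 2)) := by gcongr; exact add_sq_le_two_mul _ _
    _ = _ := by ring

lemma lintegral_pow_le_of_le_one_add {α : Type*} [MeasurableSpace α] {μ : Measure α}
    [IsProbabilityMeasure μ] {u v : α → ℝ≥0∞} (hv : Measurable v) (huv : ∀ᵐ a ∂μ, u a ≤ 1 + v a)
    {j k : ℕ} (hjk : j ≤ k) : ∫⁻ a, u a ^ j ∂μ ≤ 2 ^ k * (1 + ∫⁻ a, v a ^ k ∂μ) := by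
  calc ∫⁻ a, u a ^ j ∂μ ≤ ∫⁻ a, 2 ^ k * (1 + v a ^ k) ∂μ := by
        refine lintegral_mono_ae (huv.mono fun a ha => ?_)
        exact (pow_le_pow_left' ha j).trans (one_add_pow_le hjk _)
    _ = _ := by
        rw [lintegral_const_mul _ (by fun_prop), lintegral_add_left (by fun_prop)]
        simp

namespace IsChannel

variable {α β : Type*} [MeasurableSpace α] [MeasurableSpace β] {G : α → β → ℝ≥0∞} {ν : Measure β}
  {μ : Measure α} {u : α → ℝ≥0∞}

/-- Fluctuation of the posterior mean of `h` when the weight of the prior is perturbed by at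
most `t` and the weight of the output law is perturbed by at most the posterior mean of `v`. -/
lemma sq_lintegral_post_perturb_le [SFinite ν] (hG : IsChannel G ν) [IsProbabilityMeasure μ]
    (hu : Measurable u) [IsProbabilityMeasure (μ.withDensity u)] {h t v : α → ℝ≥0∞}
    (hh : Measurable h) (ht : Measurable t) (hv : Measurable v) {c A B : ℝ≥0∞}
    (hu9 : ∫⁻ a, u a ^ 9 ∂μ ≤ c ^ 2) (hu2 : ∫⁻ a, u a ^ 2 ∂μ ≤ c ^ 2)
    (ht8 : ∫⁻ a, t a ^ 8 ∂(μ.withDensity u) ≤ A ^ 4) (hv8 : ∫⁻ a, v a ^ 8 ∂μ ≤ B ^ 4) :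
    (∫⁻ b, (∫⁻ a, h a * (t a * (∫⁻ a, u a ∂post G μ b) + ∫⁻ a, v a ∂post G μ b)
        ∂post G (μ.withDensity u) b) ^ 2 ∂outLaw G ν (μ.withDensity u)) ^ 2 ≤
      8 * c * (∫⁻ a, h a ^ 4 ∂(μ.withDensity u)) * (A + B) ^ 2 := by
  set R : β → ℝ≥0∞ := fun b => ∫⁻ a, u a ∂post G μ b with hRdef
  set V : β → ℝ≥0∞ := fun b => ∫⁻ a, v a ∂post G μ b with hVdef
  set μ' := μ.withDensity u
  have hR : Measurable R := hG.measurable_lintegral_post (hu.comp measurable_fst)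
  have hV : Measurable V := hG.measurable_lintegral_post (hv.comp measurable_fst)
  -- Cauchy-Schwarz turns fourth powers into eighth powers; `R ^ 8` under the new output law is `R ^
  -- 9` under the old one, which is where the ninth moment of `u` comes from.
  have hT : ∫⁻ z, (t z.1 * R z.2) ^ 4 ∂jointLaw G ν μ' ≤ c * A ^ 2 := by
    refine (ENNReal.pow_le_pow_left_iff two_ne_zero).1 ?_
    simp_rw [mul_pow]
    refine (sq_lintegral_mul_le (by fun_prop) (by fun_prop)).trans ?_
    simp_rw [← pow_mul]
    rw [hG.lintegral_jointLaw_fst (F := fun a => t a ^ (4 * 2)) (by fun_prop),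
      hG.lintegral_jointLaw_snd (F := fun b => R b ^ (4 * 2)) (by fun_prop), mul_comm]
    exact mul_le_mul' ((hG.lintegral_ratio_pow_le hu _).trans hu9) ht8
  -- Here `V` is a posterior mean for the old prior, so the change of output law costs a second
  -- moment of `u`.
  have hS : ∫⁻ z, (V z.2) ^ 4 ∂jointLaw G ν μ' ≤ c * B ^ 2 := by
    refine (ENNReal.pow_le_pow_left_iff two_ne_zero).1 ?_
    rw [hG.lintegral_jointLaw_snd (F := fun b => V b ^ 4) (by fun_prop)]
    refine (hG.sq_lintegral_post_pow_le hu hv (by norm_num)).trans ?_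
    rw [mul_comm, mul_pow, ← pow_mul]
    exact mul_le_mul' hu2 hv8
  have hW : ∫⁻ z, (t z.1 * R z.2 + V z.2) ^ 4 ∂jointLaw G ν μ' ≤ 8 * (c * A ^ 2 + c * B ^ 2) := by
    calc _ ≤ ∫⁻ z, 8 * ((t z.1 * R z.2) ^ 4 + V z.2 ^ 4) ∂jointLaw G ν μ' :=
          lintegral_mono fun z => add_pow_four_le _ _
      _ = 8 * (∫⁻ z, (t z.1 * R z.2) ^ 4 ∂jointLaw G ν μ' + ∫⁻ z, V z.2 ^ 4 ∂jointLaw G ν μ') := by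
          rw [lintegral_const_mul _ (by fun_prop), lintegral_add_left (by fun_prop)]
      _ ≤ _ := by gcongr
  calc _ ≤ (∫⁻ z, h z.1 ^ 2 * (t z.1 * R z.2 + V z.2) ^ 2 ∂jointLaw G ν μ') ^ 2 := by
        gcongr
        simp_rw [← mul_pow]
        exact hG.lintegral_post_pow_outLaw_le
          (F := fun z => h z.1 * (t z.1 * R z.2 + V z.2)) (by fun_prop) one_le_two
    _ ≤ (∫⁻ z, (h z.1 ^ 2) ^ 2 ∂jointLaw G ν μ') *
        ∫⁻ z, ((t z.1 * R z.2 + V z.2) ^ 2) ^ 2 ∂jointLaw G ν μ' :=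
        sq_lintegral_mul_le (by fun_prop) (by fun_prop)
    _ ≤ (∫⁻ a, h a ^ 4 ∂μ') * (8 * (c * A ^ 2 + c * B ^ 2)) := by
        simp_rw [← pow_mul]
        rw [hG.lintegral_jointLaw_fst (F := fun a => h a ^ (2 * 2)) (by fun_prop)]
        gcongr
    _ = 8 * c * (∫⁻ a, h a ^ 4 ∂μ') * (A ^ 2 + B ^ 2) := by ring
    _ ≤ _ := by gcongr; exact sq_add_sq_le _ _

/-- Second moment of a posterior mean, under the output law of another prior, in terms of moments
of that prior. -/
lemma pow_four_lintegral_post_sq_le [SFinite ν] (hG : IsChannel G ν) [IsProbabilityMeasure μ]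
    (hu : Measurable u) [IsProbabilityMeasure (μ.withDensity u)] {h ρ : α → ℝ≥0∞}
    (hh : Measurable h) (hρ : Measurable ρ) (hμ : μ = (μ.withDensity u).withDensity ρ) :
    (∫⁻ b, (∫⁻ a, h a ∂post G μ b) ^ 2 ∂outLaw G ν (μ.withDensity u)) ^ 4 ≤
      (∫⁻ a, h a ^ 4 ∂(μ.withDensity u)) ^ 2 *
        ((∫⁻ a, ρ a ^ 4 ∂(μ.withDensity u)) * ∫⁻ a, u a ^ 5 ∂μ) := by
  set R : β → ℝ≥0∞ := fun b => ∫⁻ a, u a ∂post G μ b with hRdef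
  have hR : Measurable R := hG.measurable_lintegral_post (hu.comp measurable_fst)
  have h1 : ∫⁻ b, (∫⁻ a, h a ∂post G μ b) ^ 2 ∂outLaw G ν (μ.withDensity u) ≤
      ∫⁻ z, h z.1 ^ 2 * (ρ z.1 * R z.2) ∂jointLaw G ν (μ.withDensity u) := by
    calc _ ≤ ∫⁻ b, ∫⁻ a, h a ^ 2 * R b ∂post G μ b ∂outLaw G ν μ := by
          rw [hG.lintegral_outLaw_withDensity hu]
          refine lintegral_mono fun b => ?_
          rw [lintegral_mul_const _ (by fun_prop)]
          exact mul_le_mul' (hG.lintegral_post_pow_le hh one_le_two b) le_rfl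
      _ = ∫⁻ z, h z.1 ^ 2 * R z.2 ∂jointLaw G ν μ :=
          (hG.lintegral_jointLaw (F := fun z => h z.1 ^ 2 * R z.2) (by fun_prop)).symm
      -- The joint law is also carried back to the prior `μ.withDensity u`, at the price of the
      -- inverse weight `ρ`, so that only moments of `h` under that prior are needed.
      _ = _ := by
          conv_lhs => rw [hμ]
          rw [hG.jointLaw_withDensity hρ, lintegral_withDensity_eq_lintegral_mul _ (by fun_prop)
            (by fun_prop)]
          refine lintegral_congr fun z => ?_
          simp only [Pi.mul_apply]
          ring
  have h2 : (∫⁻ z, ρ z.1 ^ 2 * R z.2 ^ 2 ∂jointLaw G ν (μ.withDensity u)) ^ 2 ≤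
      (∫⁻ a, ρ a ^ 4 ∂(μ.withDensity u)) * ∫⁻ a, u a ^ 5 ∂μ := by
    refine (sq_lintegral_mul_le (by fun_prop) (by fun_prop)).trans ?_
    simp_rw [← pow_mul]
    rw [hG.lintegral_jointLaw_fst (F := fun a => ρ a ^ (2 * 2)) (by fun_prop),
      hG.lintegral_jointLaw_snd (F := fun b => R b ^ (2 * 2)) (by fun_prop)]
    exact mul_le_mul' le_rfl (hG.lintegral_ratio_pow_le hu 4)
  calc _ ≤ ((∫⁻ z, h z.1 ^ 2 * (ρ z.1 * R z.2) ∂jointLaw G ν (μ.withDensity u)) ^ 2) ^ 2 := by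
        rw [← pow_mul]
        gcongr
    _ ≤ ((∫⁻ z, (h z.1 ^ 2) ^ 2 ∂jointLaw G ν (μ.withDensity u)) *
          ∫⁻ z, (ρ z.1 * R z.2) ^ 2 ∂jointLaw G ν (μ.withDensity u)) ^ 2 := by
        gcongr
        exact sq_lintegral_mul_le (by fun_prop) (by fun_prop)
    _ ≤ _ := by
        simp_rw [← pow_mul, mul_pow]
        rw [hG.lintegral_jointLaw_fst (F := fun a => h a ^ (2 * 2)) (by fun_prop)]
        gcongr

end IsChannel

end SpecDiffusion

/-! ### Gaussian densities and the Gaussian channel -/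

namespace SpecDiffusion

section Gaussian

variable {d : ℕ} {σ : ℝ}

lemma gaussDensity_pos (hσ : 0 < σ) (m x : EuclideanSpace ℝ (Fin d)) : 0 < gaussDensity m σ x := by
  unfold gaussDensity
  positivity

lemma gaussDensity_le (m x : EuclideanSpace ℝ (Fin d)) :
    gaussDensity m σ x ≤ (2 * Real.pi * σ ^ 2) ^ (-(d : ℝ) / 2) := by
  unfold gaussDensity
  refine mul_le_of_le_one_right (by positivity) (Real.exp_le_one_iff.2 ?_)
  rw [neg_div]
  exact neg_nonpos.2 (by positivity)

lemma gaussDensity_comm (m x : EuclideanSpace ℝ (Fin d)) :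
    gaussDensity m σ x = gaussDensity x σ m := by
  rw [gaussDensity, gaussDensity, norm_sub_rev]

@[fun_prop]
lemma continuous_gaussDensity {X : Type*} [TopologicalSpace X]
    {m x : X → EuclideanSpace ℝ (Fin d)} (hm : Continuous m) (hx : Continuous x) :
    Continuous fun y => gaussDensity (m y) σ (x y) := by
  unfold gaussDensity
  fun_prop

lemma hasFDerivAt_gaussDensity (m x : EuclideanSpace ℝ (Fin d)) :
    HasFDerivAt (gaussDensity m σ)
      (gaussDensity m σ x • innerSL ℝ ((σ ^ 2)⁻¹ • (m - x))) x := by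
  have h1 : HasFDerivAt (fun y : EuclideanSpace ℝ (Fin d) => ‖y - m‖ ^ 2)
      (2 • (innerSL ℝ (x - m)).comp (ContinuousLinearMap.id ℝ _)) x :=
    ((hasFDerivAt_id x).sub_const m).norm_sq
  have h2 := ((h1.neg.mul_const (2 * σ ^ 2)⁻¹).exp).const_mul
    ((2 * Real.pi * σ ^ 2) ^ (-(d : ℝ) / 2))
  have h3 : gaussDensity m σ = fun y => (2 * Real.pi * σ ^ 2) ^ (-(d : ℝ) / 2) *
      Real.exp (-‖y - m‖ ^ 2 * (2 * σ ^ 2)⁻¹) := rfl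
  rw [h3]
  refine h2.congr_fderiv (ContinuousLinearMap.ext fun v => ?_)
  simp only [smul_apply, innerSL_apply_apply, inner_smul_left, smul_eq_mul, neg_apply,
    ContinuousLinearMap.comp_apply, ContinuousLinearMap.id_apply, inner_sub_left, Pi.neg_apply,
    nsmul_eq_mul, mul_inv]
  simp
  ring

lemma integral_exp_neg_norm_sub_sq (m : EuclideanSpace ℝ (Fin d)) {b : ℝ} (hb : 0 < b) :
    ∫ x, Real.exp (-b * ‖x - m‖ ^ 2) = (Real.pi / b) ^ ((d : ℝ) / 2) := by
  rw [integral_sub_right_eq_self (fun x : EuclideanSpace ℝ (Fin d) => Real.exp (-b * ‖x‖ ^ 2)) m,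
    GaussianFourier.integral_rexp_neg_mul_sq_norm hb]
  simp

lemma lintegral_exp_neg_norm_sub_sq (m : EuclideanSpace ℝ (Fin d)) {b : ℝ} (hb : 0 < b) :
    ∫⁻ x, ENNReal.ofReal (Real.exp (-b * ‖x - m‖ ^ 2)) =
      ENNReal.ofReal ((Real.pi / b) ^ ((d : ℝ) / 2)) := by
  rw [← integral_exp_neg_norm_sub_sq m hb, ofReal_integral_eq_lintegral_ofReal _
    (ae_of_all _ fun x => (Real.exp_pos _).le)]
  refine Integrable.of_integral_ne_zero ?_
  rw [integral_exp_neg_norm_sub_sq m hb]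
  positivity

lemma gaussDensity_eq (m x : EuclideanSpace ℝ (Fin d)) :
    gaussDensity m σ x = (2 * Real.pi * σ ^ 2) ^ (-(d : ℝ) / 2) *
      Real.exp (-(2 * σ ^ 2)⁻¹ * ‖x - m‖ ^ 2) := by
  rw [gaussDensity]
  ring_nf

lemma lintegral_gaussDensity (hσ : 0 < σ) (m : EuclideanSpace ℝ (Fin d)) :
    ∫⁻ x, ENNReal.ofReal (gaussDensity m σ x) = 1 := by
  simp_rw [gaussDensity_eq]
  have h0 : (0 : ℝ) ≤ (2 * Real.pi * σ ^ 2) ^ (-(d : ℝ) / 2) := by positivity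
  simp_rw [ENNReal.ofReal_mul h0]
  rw [lintegral_const_mul' _ _ (by simp), lintegral_exp_neg_norm_sub_sq m (by positivity),
    ← ENNReal.ofReal_mul h0]
  have : Real.pi / (2 * σ ^ 2)⁻¹ = 2 * Real.pi * σ ^ 2 := by field_simp
  rw [this, neg_div, ← Real.rpow_add (by positivity)]
  simp

/-- Half of the exponent absorbs the fourth power, through `t² exp (-t) ≤ 2`; the other half is a
Gaussian of variance `2σ²`, whose normalisation gives the factor `2 ^ (d / 2)`. -/
lemma lintegral_norm_sub_pow_four_gaussDensity_le (hσ : 0 < σ) (m : EuclideanSpace ℝ (Fin d)) :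
    ∫⁻ x, ‖x - m‖ₑ ^ 4 * ENNReal.ofReal (gaussDensity m σ x) ≤
      ENNReal.ofReal (32 * 2 ^ ((d : ℝ) / 2) * σ ^ 4) := by
  set c := (2 * Real.pi * σ ^ 2) ^ (-(d : ℝ) / 2) with hc
  have h0 : 0 ≤ c * (32 * σ ^ 4) := by positivity
  calc _ ≤ ∫⁻ x, ENNReal.ofReal (c * (32 * σ ^ 4)) *
        ENNReal.ofReal (Real.exp (-(4 * σ ^ 2)⁻¹ * ‖x - m‖ ^ 2)) := by
        refine lintegral_mono fun x => ?_
        rw [← ofReal_norm, ← ENNReal.ofReal_pow (norm_nonneg _),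
          ← ENNReal.ofReal_mul (by positivity), ← ENNReal.ofReal_mul h0, gaussDensity_eq]
        refine ENNReal.ofReal_le_ofReal ?_
        set t := (4 * σ ^ 2)⁻¹ * ‖x - m‖ ^ 2 with ht
        have ht0 : 0 ≤ t := by positivity
        have h1 : ‖x - m‖ ^ 4 = 16 * σ ^ 4 * t ^ 2 := by
          rw [ht]; field_simp; norm_num
        have h2 : Real.exp (-(2 * σ ^ 2)⁻¹ * ‖x - m‖ ^ 2) = Real.exp (-t) * Real.exp (-t) := by
          rw [← Real.exp_add, ht]; congr 1; field_simp; ring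
        have h3 : Real.exp (-(4 * σ ^ 2)⁻¹ * ‖x - m‖ ^ 2) = Real.exp (-t) := by
          rw [ht, neg_mul]
        rw [h1, h2, h3]
        have h4 : t ^ 2 * Real.exp (-t) ≤ 2 := by
          have := Real.quadratic_le_exp_of_nonneg ht0
          rw [Real.exp_neg, ← div_eq_mul_inv, div_le_iff₀ (Real.exp_pos _)]
          nlinarith
        calc 16 * σ ^ 4 * t ^ 2 * (c * (Real.exp (-t) * Real.exp (-t)))
            = c * (16 * σ ^ 4) * Real.exp (-t) * (t ^ 2 * Real.exp (-t)) := by ring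
          _ ≤ c * (16 * σ ^ 4) * Real.exp (-t) * 2 := by gcongr
          _ = _ := by ring
    _ = ENNReal.ofReal (c * (32 * σ ^ 4) * (Real.pi / (4 * σ ^ 2)⁻¹) ^ ((d : ℝ) / 2)) := by
        rw [lintegral_const_mul' _ _ (by simp), lintegral_exp_neg_norm_sub_sq m (by positivity),
          ← ENNReal.ofReal_mul h0]
    _ = _ := by
        congr 1
        have : Real.pi / (4 * σ ^ 2)⁻¹ = 2 * (2 * Real.pi * σ ^ 2) := by field_simp; norm_num
        rw [this, Real.mul_rpow (by norm_num) (by positivity), hc, neg_div,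
          Real.rpow_neg (by positivity)]
        field_simp

end Gaussian

section Posterior

variable {d : ℕ} {f g : ℝ → ℝ} {s : ℝ} {p : EuclideanSpace ℝ (Fin d) → ℝ}

/-- The Gaussian channel `x₀ ↦ N(α_s x₀, σ_s² Id)`. -/
noncomputable def gaussChannel (d : ℕ) (f g : ℝ → ℝ) (s : ℝ)
    (x₀ x : EuclideanSpace ℝ (Fin d)) : ℝ≥0∞ :=
  ENNReal.ofReal (gaussDensity (alphaCoef f s • x₀) (sigmaCoef f g s) x)

/-- The law with density `p`. -/
noncomputable def densityLaw (p : EuclideanSpace ℝ (Fin d) → ℝ) :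
    Measure (EuclideanSpace ℝ (Fin d)) :=
  volume.withDensity fun x => ENNReal.ofReal (p x)

lemma isChannel_gaussChannel (hσ : 0 < sigmaCoef f g s) :
    IsChannel (gaussChannel d f g s) volume where
  measurable := by
    refine ENNReal.measurable_ofReal.comp (Continuous.measurable ?_)
    fun_prop
  lintegral_eq_one x₀ := lintegral_gaussDensity hσ _
  pos x₀ x := by simpa [gaussChannel] using gaussDensity_pos hσ _ _
  bdd := ⟨((2 * Real.pi * sigmaCoef f g s ^ 2) ^ (-(d : ℝ) / 2)).toNNReal, fun x₀ x => by
    exact ENNReal.ofReal_le_ofReal (gaussDensity_le _ _)⟩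

lemma alphaCoef_pos (f : ℝ → ℝ) (t : ℝ) : 0 < alphaCoef f t := Real.exp_pos _

namespace IsC1Density

lemma measurable (hp : IsC1Density p) : Measurable p := hp.contDiff.continuous.measurable

lemma isProbabilityMeasure (hp : IsC1Density p) : IsProbabilityMeasure (densityLaw p) :=
  ⟨by rw [densityLaw, withDensity_apply _ MeasurableSet.univ]; simpa using hp.lintegral_eq_one⟩

lemma integrable (hp : IsC1Density p) : Integrable p := by
  refine ⟨hp.measurable.aestronglyMeasurable, ?_⟩
  rw [hasFiniteIntegral_iff_ofReal (ae_of_all _ hp.nonneg), hp.lintegral_eq_one]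
  exact ENNReal.one_lt_top

lemma lintegral_densityLaw (hp : IsC1Density p) (F : EuclideanSpace ℝ (Fin d) → ℝ≥0∞) :
    ∫⁻ x, F x ∂densityLaw p = ∫⁻ x, F x * ENNReal.ofReal (p x) := by
  rw [densityLaw, lintegral_withDensity_eq_lintegral_mul_non_measurable _
    hp.measurable.ennreal_ofReal (by simp)]
  simp [mul_comm]

lemma integrable_mul_gaussDensity (hp : IsC1Density p) (x : EuclideanSpace ℝ (Fin d)) :
    Integrable fun x₀ => p x₀ * gaussDensity (alphaCoef f s • x₀) (sigmaCoef f g s) x := by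
  refine hp.integrable.mul_bdd (c := (2 * Real.pi * sigmaCoef f g s ^ 2) ^ (-(d : ℝ) / 2))
    (Continuous.aestronglyMeasurable (by fun_prop)) (ae_of_all _ fun x₀ => ?_)
  rw [Real.norm_of_nonneg (by unfold gaussDensity; positivity)]
  exact gaussDensity_le _ _

lemma mix_gaussChannel (hp : IsC1Density p) (hσ : 0 < sigmaCoef f g s)
    (x : EuclideanSpace ℝ (Fin d)) :
    mix (gaussChannel d f g s) (densityLaw p) x = ENNReal.ofReal (marginal f g p s x) := by
  rw [mix, hp.lintegral_densityLaw, marginal, ofReal_integral_eq_lintegral_ofReal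
    (hp.integrable_mul_gaussDensity x)
    (ae_of_all _ fun x₀ => mul_nonneg (hp.nonneg x₀) (gaussDensity_pos hσ _ _).le)]
  refine lintegral_congr fun x₀ => ?_
  rw [ENNReal.ofReal_mul (hp.nonneg x₀), mul_comm, gaussChannel]

lemma marginal_pos (hp : IsC1Density p) (hσ : 0 < sigmaCoef f g s)
    (x : EuclideanSpace ℝ (Fin d)) : 0 < marginal f g p s x := by
  have := hp.isProbabilityMeasure
  have h := (isChannel_gaussChannel (d := d) hσ).mix_ne_zero (μ := densityLaw p) x
  rw [hp.mix_gaussChannel hσ] at h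
  simpa using h

lemma outLaw_gaussChannel (hp : IsC1Density p) (hσ : 0 < sigmaCoef f g s) :
    outLaw (gaussChannel d f g s) volume (densityLaw p) = densityLaw (marginal f g p s) := by
  rw [outLaw, densityLaw]
  congr 1
  exact funext (hp.mix_gaussChannel hσ)

lemma measurable_posterior (hp : IsC1Density p) (x : EuclideanSpace ℝ (Fin d)) :
    Measurable fun x₀ => posterior f g p s x₀ x := by
  unfold posterior
  refine (hp.measurable.mul (Continuous.measurable ?_)).div_const _
  fun_prop

lemma posterior_nonneg (hp : IsC1Density p) (hσ : 0 < sigmaCoef f g s)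
    (x₀ x : EuclideanSpace ℝ (Fin d)) : 0 ≤ posterior f g p s x₀ x :=
  div_nonneg (mul_nonneg (hp.nonneg _) (gaussDensity_pos hσ _ _).le) (hp.marginal_pos hσ x).le

lemma post_gaussChannel (hp : IsC1Density p) (hσ : 0 < sigmaCoef f g s)
    (x : EuclideanSpace ℝ (Fin d)) :
    post (gaussChannel d f g s) (densityLaw p) x =
      densityLaw fun x₀ => posterior f g p s x₀ x := by
  have hm := (isChannel_gaussChannel (d := d) hσ).measurable_left x
  rw [post, hp.mix_gaussChannel hσ, densityLaw, ← withDensity_mul _ hp.measurable.ennreal_ofReal hm,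
    ← withDensity_smul _ (hp.measurable.ennreal_ofReal.mul hm), densityLaw]
  congr 1
  funext x₀
  simp only [Pi.smul_apply, Pi.mul_apply, smul_eq_mul, gaussChannel, posterior]
  rw [ENNReal.ofReal_div_of_pos (hp.marginal_pos hσ x), ENNReal.ofReal_mul (hp.nonneg x₀), mul_comm,
    ENNReal.div_eq_inv_mul, mul_comm]

lemma integral_post (hp : IsC1Density p) (hσ : 0 < sigmaCoef f g s)
    (x : EuclideanSpace ℝ (Fin d)) (F : EuclideanSpace ℝ (Fin d) → EuclideanSpace ℝ (Fin d)) :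
    ∫ x₀, F x₀ ∂post (gaussChannel d f g s) (densityLaw p) x =
      ∫ x₀, posterior f g p s x₀ x • F x₀ := by
  rw [hp.post_gaussChannel hσ, densityLaw, integral_withDensity_eq_integral_toReal_smul
    (hp.measurable_posterior x).ennreal_ofReal (by simp)]
  refine integral_congr_ae (ae_of_all _ fun x₀ => ?_)
  simp [ENNReal.toReal_ofReal (hp.posterior_nonneg hσ x₀ x)]

lemma integrable_post_iff (hp : IsC1Density p) (hσ : 0 < sigmaCoef f g s)
    (x : EuclideanSpace ℝ (Fin d)) (F : EuclideanSpace ℝ (Fin d) → EuclideanSpace ℝ (Fin d)) :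
    Integrable F (post (gaussChannel d f g s) (densityLaw p) x) ↔
      Integrable fun x₀ => posterior f g p s x₀ x • F x₀ := by
  rw [hp.post_gaussChannel hσ, densityLaw, integrable_withDensity_iff_integrable_smul'
    (hp.measurable_posterior x).ennreal_ofReal (by simp)]
  simp_rw [ENNReal.toReal_ofReal (hp.posterior_nonneg hσ _ x)]

end IsC1Density

end Posterior

end SpecDiffusion

/-! ### Noised scores as posterior means -/

namespace SpecDiffusion

variable {d : ℕ} {f g : ℝ → ℝ} {s : ℝ} {p : EuclideanSpace ℝ (Fin d) → ℝ}

lemma measurable_score (p : EuclideanSpace ℝ (Fin d) → ℝ) : Measurable (score p) := by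
  unfold score gradient
  exact (InnerProductSpace.toDual ℝ _).symm.continuous.measurable.comp
    (measurable_fderiv ℝ fun y => Real.log (p y))

lemma score_eq_of_hasGradientAt {x v : EuclideanSpace ℝ (Fin d)} (h : HasGradientAt p v x)
    (hx : p x ≠ 0) : score p x = (p x)⁻¹ • v := by
  refine HasGradientAt.gradient ?_
  rw [hasGradientAt_iff_hasFDerivAt] at h ⊢
  simpa using h.log hx

/-- The bound does not depend on `x`, so it dominates the differentiated integrand globally. It
follows from `r ≤ 1 + r²/2 ≤ exp (r²/2)` with `r = ‖m - x‖ / σ`. -/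
lemma norm_sub_mul_gaussDensity_le {σ : ℝ} (hσ : 0 < σ) (m x : EuclideanSpace ℝ (Fin d)) :
    ‖m - x‖ * gaussDensity m σ x ≤ σ * (2 * Real.pi * σ ^ 2) ^ (-(d : ℝ) / 2) := by
  rw [gaussDensity_eq, norm_sub_rev x m]
  set t := (2 * σ ^ 2)⁻¹ * ‖m - x‖ ^ 2 with ht
  have h1 : ‖m - x‖ ≤ σ * Real.exp t := by
    have h2 : ‖m - x‖ / σ ≤ t + 1 := by
      have : t = (‖m - x‖ / σ) ^ 2 / 2 := by rw [ht]; field_simp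
      rw [this]
      nlinarith [sq_nonneg (‖m - x‖ / σ - 1)]
    rw [div_le_iff₀ hσ] at h2
    nlinarith [Real.add_one_le_exp t]
  have h3 : ‖m - x‖ * Real.exp (-t) ≤ σ := by
    rw [Real.exp_neg, ← div_eq_mul_inv, div_le_iff₀ (Real.exp_pos _)]
    exact h1
  have h4 : (0 : ℝ) ≤ (2 * Real.pi * σ ^ 2) ^ (-(d : ℝ) / 2) := by positivity
  rw [neg_mul, ← ht]
  nlinarith

namespace IsC1Density

/-- A zero of `p` is a minimum, so the gradient vanishes there and the value chosen for the score is
irrelevant. This gives `∇p = p ∇log p` without a positivity assumption. -/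
lemma fderiv_eq_score (hp : IsC1Density p) (x v : EuclideanSpace ℝ (Fin d)) :
    fderiv ℝ p x v = p x * inner ℝ (score p x) v := by
  by_cases hx : p x = 0
  · have : IsLocalMin p x := Filter.Eventually.of_forall fun y => hx ▸ hp.nonneg y
    simp [this.fderiv_eq_zero, hx]
  · have hd : DifferentiableAt ℝ p x := hp.contDiff.differentiable one_ne_zero x
    rw [score_eq_of_hasGradientAt hd.hasGradientAt hx, inner_smul_left, gradient]
    simp [hx]

lemma norm_smul_sub_le (hp : IsC1Density p) (hσ : 0 < sigmaCoef f g s)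
    (x₀ x : EuclideanSpace ℝ (Fin d)) :
    ‖(p x₀ * gaussDensity (alphaCoef f s • x₀) (sigmaCoef f g s) x) •
        (sigmaCoef f g s ^ 2)⁻¹ • (alphaCoef f s • x₀ - x)‖ ≤
      p x₀ * ((sigmaCoef f g s ^ 2)⁻¹ * (sigmaCoef f g s *
        (2 * Real.pi * sigmaCoef f g s ^ 2) ^ (-(d : ℝ) / 2))) := by
  rw [norm_smul, norm_smul, Real.norm_of_nonneg (mul_nonneg (hp.nonneg _)
    (gaussDensity_pos hσ _ _).le), Real.norm_of_nonneg (by positivity)]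
  calc _ = p x₀ * ((sigmaCoef f g s ^ 2)⁻¹ * (‖alphaCoef f s • x₀ - x‖ *
        gaussDensity (alphaCoef f s • x₀) (sigmaCoef f g s) x)) := by ring
    _ ≤ _ := mul_le_mul_of_nonneg_left (mul_le_mul_of_nonneg_left
        (norm_sub_mul_gaussDensity_le hσ _ _) (by positivity)) (hp.nonneg _)

lemma integrable_smul_sub (hp : IsC1Density p) (hσ : 0 < sigmaCoef f g s)
    (x : EuclideanSpace ℝ (Fin d)) :
    Integrable fun x₀ => (p x₀ * gaussDensity (alphaCoef f s • x₀) (sigmaCoef f g s) x) •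
        (sigmaCoef f g s ^ 2)⁻¹ • (alphaCoef f s • x₀ - x) := by
  have := hp.contDiff.continuous
  exact (hp.integrable.mul_const _).mono' (Continuous.aestronglyMeasurable (by fun_prop))
    (ae_of_all _ fun x₀ => hp.norm_smul_sub_le hσ x₀ x)

lemma hasGradientAt_marginal (hp : IsC1Density p) (hσ : 0 < sigmaCoef f g s)
    (x : EuclideanSpace ℝ (Fin d)) :
    HasGradientAt (marginal f g p s)
      (∫ x₀, (p x₀ * gaussDensity (alphaCoef f s • x₀) (sigmaCoef f g s) x) •
        (sigmaCoef f g s ^ 2)⁻¹ • (alphaCoef f s • x₀ - x)) x := by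
  rw [hasGradientAt_iff_hasFDerivAt]
  have hc := hp.contDiff.continuous
  have h := hasFDerivAt_integral_of_dominated_of_fderiv_le (𝕜 := ℝ) (μ := volume)
    (F := fun x x₀ => p x₀ * gaussDensity (alphaCoef f s • x₀) (sigmaCoef f g s) x)
    (F' := fun x x₀ => innerSL ℝ ((p x₀ * gaussDensity (alphaCoef f s • x₀) (sigmaCoef f g s) x) •
        (sigmaCoef f g s ^ 2)⁻¹ • (alphaCoef f s • x₀ - x))) (x₀ := x)
    (bound := fun x₀ => p x₀ * ((sigmaCoef f g s ^ 2)⁻¹ * (sigmaCoef f g s *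
        (2 * Real.pi * sigmaCoef f g s ^ 2) ^ (-(d : ℝ) / 2)))) Filter.univ_mem
    (Filter.Eventually.of_forall fun y => Continuous.aestronglyMeasurable (by fun_prop))
    (hp.integrable_mul_gaussDensity x)
    (Continuous.aestronglyMeasurable (by fun_prop))
    (ae_of_all _ fun x₀ y _ => by
      rw [innerSL_apply_norm]
      exact hp.norm_smul_sub_le hσ x₀ y)
    (hp.integrable.mul_const _)
    (ae_of_all _ fun x₀ y _ => by
      refine ((hasFDerivAt_gaussDensity _ y).const_mul (p x₀)).congr_fderiv ?_
      simp only [mul_smul, map_smul])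
  refine h.congr_fderiv ?_
  rw [ContinuousLinearMap.integral_comp_comm _ (hp.integrable_smul_sub hσ x)]
  rfl

lemma score_marginal (hp : IsC1Density p) (hσ : 0 < sigmaCoef f g s)
    (x : EuclideanSpace ℝ (Fin d)) :
    score (marginal f g p s) x = (marginal f g p s x)⁻¹ •
      ∫ x₀, (p x₀ * gaussDensity (alphaCoef f s • x₀) (sigmaCoef f g s) x) •
        (sigmaCoef f g s ^ 2)⁻¹ • (alphaCoef f s • x₀ - x) :=
  score_eq_of_hasGradientAt (hp.hasGradientAt_marginal hσ x) (hp.marginal_pos hσ x).ne'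

lemma inv_marginal_smul_integral (hp : IsC1Density p) (hσ : 0 < sigmaCoef f g s)
    (x : EuclideanSpace ℝ (Fin d)) (F : EuclideanSpace ℝ (Fin d) → EuclideanSpace ℝ (Fin d)) :
    (marginal f g p s x)⁻¹ •
      ∫ x₀, (p x₀ * gaussDensity (alphaCoef f s • x₀) (sigmaCoef f g s) x) • F x₀ =
    ∫ x₀, F x₀ ∂post (gaussChannel d f g s) (densityLaw p) x := by
  rw [hp.integral_post hσ, ← integral_smul]
  refine integral_congr_ae (ae_of_all _ fun x₀ => ?_)
  simp only [posterior, smul_smul]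
  congr 1
  ring

/-- Tweedie's formula. -/
lemma score_marginal_eq_integral_sub (hp : IsC1Density p) (hσ : 0 < sigmaCoef f g s)
    (x : EuclideanSpace ℝ (Fin d)) :
    score (marginal f g p s) x = ∫ x₀, (sigmaCoef f g s ^ 2)⁻¹ • (alphaCoef f s • x₀ - x)
      ∂post (gaussChannel d f g s) (densityLaw p) x := by
  rw [hp.score_marginal hσ, hp.inv_marginal_smul_integral hσ]

/-- The score of the output law is the rescaled posterior mean of the score of the input law. -/
lemma smul_score_marginal_eq_integral_score (hp : IsC1Density p) (hσ : 0 < sigmaCoef f g s)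
    (hint : ∀ x, Integrable (fun x₀ => ‖score p x₀‖ * posterior f g p s x₀ x))
    (x : EuclideanSpace ℝ (Fin d)) :
    alphaCoef f s • score (marginal f g p s) x =
      ∫ x₀, score p x₀ ∂post (gaussChannel d f g s) (densityLaw p) x := by
  have hm := hp.marginal_pos (f := f) (g := g) (s := s) hσ x
  set a := alphaCoef f s
  set σ := sigmaCoef f g s
  have hI : Integrable fun x₀ => (p x₀ * gaussDensity (a • x₀) σ x) • score p x₀ := by
    refine ((hint x).const_mul (marginal f g p s x)).mono ?_ (ae_of_all _ fun x₀ => ?_)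
    · exact ((hp.measurable.mul (Continuous.measurable (by fun_prop))).smul
        (measurable_score p)).aestronglyMeasurable
    · simp only [norm_smul, norm_mul, norm_norm, posterior, norm_div]
      have : ‖marginal f g p s x‖ ≠ 0 := by simpa using hm.ne'
      rw [mul_left_comm, mul_div_cancel₀ _ this, mul_comm]
  have hJ := hp.integrable_smul_sub (f := f) (g := g) (s := s) hσ x
  rw [hp.score_marginal hσ, ← hp.inv_marginal_smul_integral hσ, smul_comm]
  congr 1
  refine ext_inner_right ℝ fun v => ?_
  rw [inner_smul_left, real_inner_comm, ← integral_inner hJ, real_inner_comm, ← integral_inner hI]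
  have hG : ∀ x₀, HasFDerivAt (fun y => gaussDensity (a • y) σ x)
      ((gaussDensity (a • x₀) σ x • innerSL ℝ ((σ ^ 2)⁻¹ • (x - a • x₀))).comp
        (a • ContinuousLinearMap.id ℝ _)) x₀ := by
    intro x₀
    simp_rw [gaussDensity_comm _ x]
    exact (hasFDerivAt_gaussDensity x (a • x₀)).comp x₀ ((hasFDerivAt_id x₀).const_smul a)
  -- The kernel depends on `a • x₀ - x` only, so its derivative in `x₀` is `-a` times its derivative
  -- in `x`; this is the source of the factor `alphaCoef`.
  have hG' : ∀ x₀, p x₀ * fderiv ℝ (fun y => gaussDensity (a • y) σ x) x₀ v =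
      -(a * inner ℝ v ((p x₀ * gaussDensity (a • x₀) σ x) • (σ ^ 2)⁻¹ • (a • x₀ - x))) := by
    intro x₀
    rw [(hG x₀).fderiv]
    simp only [ContinuousLinearMap.comp_apply, smul_apply, ContinuousLinearMap.id_apply,
      innerSL_apply_apply, inner_smul_left, inner_smul_right, smul_eq_mul]
    rw [← neg_sub (a • x₀) x, inner_neg_left, real_inner_comm v]
    simp
    ring
  have hS : ∀ x₀, fderiv ℝ p x₀ v * gaussDensity (a • x₀) σ x =
      inner ℝ v ((p x₀ * gaussDensity (a • x₀) σ x) • score p x₀) := by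
    intro x₀
    rw [hp.fderiv_eq_score, inner_smul_right, real_inner_comm v]
    ring
  have key := integral_mul_fderiv_eq_neg_fderiv_mul_of_integrable (𝕜 := ℝ) (μ := volume) (f := p)
    (g := fun y => gaussDensity (a • y) σ x) (v := v)
    (by simp_rw [hS]; exact hI.const_inner v)
    (by simp_rw [hG']; exact ((hJ.const_inner v).const_mul a).neg)
    (hp.integrable_mul_gaussDensity x)
    (fun x₀ _ => hp.contDiff.differentiable one_ne_zero x₀)
    (fun x₀ _ => (hG x₀).differentiableAt)
  simp_rw [hG', hS, integral_neg, integral_const_mul, neg_inj] at key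
  simpa using key

end IsC1Density

end SpecDiffusion

/-! ### Density ratios and their moments -/

namespace SpecDiffusion

variable {d : ℕ} {p q : EuclideanSpace ℝ (Fin d) → ℝ}

/-- The density of the law `q` with respect to the law `p`. -/
noncomputable def densityRatio (q p : EuclideanSpace ℝ (Fin d) → ℝ)
    (x : EuclideanSpace ℝ (Fin d)) : ℝ≥0∞ :=
  ENNReal.ofReal (q x / p x)

/-- The distance to `1` of the density of the law `q` with respect to the law `p`. -/
noncomputable def ratioDev (q p : EuclideanSpace ℝ (Fin d) → ℝ)
    (x : EuclideanSpace ℝ (Fin d)) : ℝ≥0∞ :=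
  ‖1 - q x / p x‖ₑ

lemma densityRatio_le (q p : EuclideanSpace ℝ (Fin d) → ℝ) (x : EuclideanSpace ℝ (Fin d)) :
    densityRatio q p x ≤ 1 + ratioDev q p x := by
  rw [densityRatio, ratioDev, Real.enorm_eq_ofReal_abs, ← ENNReal.ofReal_one,
    ← ENNReal.ofReal_add zero_le_one (abs_nonneg _)]
  refine ENNReal.ofReal_le_ofReal ?_
  linarith [neg_abs_le (1 - q x / p x)]

namespace IsC1Density

/-- With `densityRatio_le`, this expresses `|q/p - 1|` by two additive inequalities, which can be
integrated in `ℝ≥0∞` without subtraction. -/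
lemma one_le_densityRatio_add (hp : IsC1Density p) (hq : IsC1Density q)
    (x : EuclideanSpace ℝ (Fin d)) : 1 ≤ densityRatio q p x + ratioDev q p x := by
  rw [densityRatio, ratioDev, Real.enorm_eq_ofReal_abs, ← ENNReal.ofReal_one,
    ← ENNReal.ofReal_add (div_nonneg (hq.nonneg x) (hp.nonneg x)) (abs_nonneg _)]
  refine ENNReal.ofReal_le_ofReal ?_
  linarith [le_abs_self (1 - q x / p x)]

lemma measurable_densityRatio (hp : IsC1Density p) (hq : IsC1Density q) :
    Measurable (densityRatio q p) :=
  (hq.measurable.div hp.measurable).ennreal_ofReal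

lemma measurable_ratioDev (hp : IsC1Density p) (hq : IsC1Density q) :
    Measurable (ratioDev q p) :=
  (measurable_const.sub (hq.measurable.div hp.measurable)).enorm

/-- The value `⊤` assigned where `p` vanishes and `q` does not makes a finite divergence force
absolute continuity. -/
lemma ae_eq_zero_of_chiDiv_ne_top (hp : IsC1Density p) (hq : IsC1Density q) {k : ℕ}
    (h : chiDiv k q p ≠ ⊤) : ∀ᵐ x, p x = 0 → q x = 0 := by
  have hp' := hp.measurable
  have hq' := hq.measurable
  have hm : Measurable fun x => if p x = 0 then (if q x = 0 then 0 else (⊤ : ℝ≥0∞))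
      else ENNReal.ofReal (|1 - q x / p x| ^ k * p x) := by
    refine Measurable.ite (hp' (measurableSet_singleton 0)) (Measurable.ite
      (hq' (measurableSet_singleton 0)) measurable_const measurable_const) ?_
    exact (((measurable_const.sub (hq'.div hp')).abs.pow_const k).mul hp').ennreal_ofReal
  filter_upwards [ae_lt_top hm h] with x hx hpx
  by_contra hqx
  simp [hpx, hqx] at hx

lemma lintegral_ratioDev_pow (hp : IsC1Density p) (hpq : ∀ᵐ x, p x = 0 → q x = 0) (k : ℕ) :
    ∫⁻ x, ratioDev q p x ^ k ∂densityLaw p = chiDiv k q p := by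
  rw [hp.lintegral_densityLaw, chiDiv]
  refine lintegral_congr_ae (hpq.mono fun x hx => ?_)
  by_cases hpx : p x = 0
  · simp [hpx, hx hpx]
  · simp only [hpx, if_false]
    rw [ENNReal.ofReal_mul (by positivity), ENNReal.ofReal_pow (abs_nonneg _), ratioDev,
      Real.enorm_eq_ofReal_abs]

lemma sq_lintegral_ratioDev_pow_le (hp : IsC1Density p) (hq : IsC1Density q) (k : ℕ)
    (hpq : ∀ᵐ x, p x = 0 → q x = 0) :
    (∫⁻ x, ratioDev q p x ^ k ∂densityLaw p) ^ 2 ≤ chiDiv (k * 2) q p := by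
  have := hp.isProbabilityMeasure
  rw [← hp.lintegral_ratioDev_pow hpq]
  simp_rw [pow_mul]
  exact lintegral_pow_le ((hp.measurable_ratioDev hq).pow_const k).aemeasurable one_le_two

lemma densityLaw_withDensity (hp : IsC1Density p) (hq : IsC1Density q)
    (hpq : ∀ᵐ x, p x = 0 → q x = 0) :
    (densityLaw p).withDensity (densityRatio q p) = densityLaw q := by
  rw [densityLaw, ← withDensity_mul _ hp.measurable.ennreal_ofReal
    (hp.measurable_densityRatio hq), densityLaw]
  refine withDensity_congr_ae (hpq.mono fun x hx => ?_)
  simp only [Pi.mul_apply, densityRatio]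
  rw [← ENNReal.ofReal_mul (hp.nonneg x)]
  by_cases hpx : p x = 0
  · simp [hpx, hx hpx]
  · rw [mul_div_cancel₀ _ hpx]

lemma lintegral_densityRatio_pow_le (hp : IsC1Density p) (hq : IsC1Density q)
    (hpq : ∀ᵐ x, p x = 0 → q x = 0) {j k : ℕ} (hjk : j ≤ k) :
    ∫⁻ x, densityRatio q p x ^ j ∂densityLaw p ≤ 2 ^ k * (1 + chiDiv k q p) := by
  have := hp.isProbabilityMeasure
  rw [← hp.lintegral_ratioDev_pow hpq]
  exact lintegral_pow_le_of_le_one_add (hp.measurable_ratioDev hq)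
    (ae_of_all _ fun x => densityRatio_le q p x) hjk

variable {f g : ℝ → ℝ} {s : ℝ}

lemma lintegral_post_sq_le (hp : IsC1Density p) (hq : IsC1Density q) {M : ℝ≥0∞} (hM : M ≠ ⊤)
    (hχ : chiDiv 2 q p ≤ M) (hσ : 0 < sigmaCoef f g s)
    {F : EuclideanSpace ℝ (Fin d) × EuclideanSpace ℝ (Fin d) → ℝ≥0∞} (hF : Measurable F)
    {c : ℝ≥0∞} (hc : ∫⁻ z, F z ^ 4 ∂jointLaw (gaussChannel d f g s) volume (densityLaw p) ≤ c ^ 2) :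
    ∫⁻ x, (∫⁻ x₀, F (x₀, x) ∂post (gaussChannel d f g s) (densityLaw p) x) ^ 2
      ∂densityLaw (marginal f g q s) ≤ 2 * (1 + M) * c := by
  have := hp.isProbabilityMeasure
  have := hq.isProbabilityMeasure
  have hpq := hp.ae_eq_zero_of_chiDiv_ne_top hq (hχ.trans_lt hM.lt_top).ne
  have hu := hp.measurable_densityRatio hq
  have hG := isChannel_gaussChannel (d := d) hσ
  have hd := hp.densityLaw_withDensity hq hpq
  have : IsProbabilityMeasure ((densityLaw p).withDensity (densityRatio q p)) := by rwa [hd]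
  have h := hG.sq_lintegral_post_sq_le (μ := densityLaw p) hu hF
  rw [hd, hq.outLaw_gaussChannel hσ] at h
  refine (ENNReal.pow_le_pow_left_iff two_ne_zero).1 (h.trans ?_)
  calc _ ≤ (2 ^ 2 * (1 + chiDiv 2 q p)) * c ^ 2 :=
        mul_le_mul' (hp.lintegral_densityRatio_pow_le hq hpq le_rfl) hc
    _ ≤ (2 ^ 2 * (1 + M)) * c ^ 2 := by gcongr
    _ ≤ (2 ^ 2 * (1 + M) ^ 2) * c ^ 2 := by
        gcongr
        exact le_self_pow₀ le_self_add two_ne_zero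
    _ = _ := by ring

lemma chiDiv_self {k : ℕ} (hk : k ≠ 0) : chiDiv k p p = 0 := by
  rw [chiDiv, ← lintegral_zero (μ := (volume : Measure (EuclideanSpace ℝ (Fin d))))]
  refine lintegral_congr fun x => ?_
  by_cases hx : p x = 0 <;> simp [hx, hk]

end IsC1Density

/-! ### The score gap in terms of the noise level -/

lemma lintegral_enorm_sub_sq_le {α E : Type*} [MeasurableSpace α] [NormedAddCommGroup E]
    {μ : Measure α} {F G : α → E} {A B : α → ℝ≥0∞} (hA : ∀ x, ‖F x‖ₑ ≤ A x)
    (hB : ∀ x, ‖G x‖ₑ ≤ B x) {a b : ℝ≥0∞} (hAm : Measurable A) (ha : ∫⁻ x, A x ^ 2 ∂μ ≤ a)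
    (hb : ∫⁻ x, B x ^ 2 ∂μ ≤ b) : ∫⁻ x, ‖F x - G x‖ₑ ^ 2 ∂μ ≤ 2 * (a + b) := by
  calc _ ≤ ∫⁻ x, 2 * (A x ^ 2 + B x ^ 2) ∂μ := by
        refine lintegral_mono fun x => ?_
        refine (pow_le_pow_left' enorm_sub_le 2).trans ((add_sq_le_two_mul _ _).trans ?_)
        gcongr
        · exact hA x
        · exact hB x
    _ = 2 * (∫⁻ x, A x ^ 2 ∂μ + ∫⁻ x, B x ^ 2 ∂μ) := by
        rw [lintegral_const_mul' _ _ (by simp), lintegral_add_left (by fun_prop)]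
    _ ≤ _ := by gcongr

namespace IsC1Density

variable {f g : ℝ → ℝ} {s : ℝ}

lemma lintegral_sub_integral_post_sq_le (hp : IsC1Density p) (hq : IsC1Density q) {M : ℝ≥0∞}
    (hM : M ≠ ⊤) (hχ : chiDiv 2 q p ≤ M) (hσ : 0 < sigmaCoef f g s)
    {F : EuclideanSpace ℝ (Fin d) × EuclideanSpace ℝ (Fin d) → EuclideanSpace ℝ (Fin d)}
    (hF : Measurable F) {c : ℝ≥0∞}
    (hcp : ∫⁻ z, ‖F z‖ₑ ^ 4 ∂jointLaw (gaussChannel d f g s) volume (densityLaw p) ≤ c ^ 2)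
    (hcq : ∫⁻ z, ‖F z‖ₑ ^ 4 ∂jointLaw (gaussChannel d f g s) volume (densityLaw q) ≤ c ^ 2) :
    ∫⁻ x, ‖∫ x₀, F (x₀, x) ∂post (gaussChannel d f g s) (densityLaw p) x -
        ∫ x₀, F (x₀, x) ∂post (gaussChannel d f g s) (densityLaw q) x‖ₑ ^ 2
      ∂densityLaw (marginal f g q s) ≤ 8 * (1 + M) * c := by
  have := hp.isProbabilityMeasure
  have hG := isChannel_gaussChannel (d := d) hσ
  refine (lintegral_enorm_sub_sq_le
    (A := fun x => ∫⁻ x₀, ‖F (x₀, x)‖ₑ ∂post (gaussChannel d f g s) (densityLaw p) x)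
    (B := fun x => ∫⁻ x₀, ‖F (x₀, x)‖ₑ ∂post (gaussChannel d f g s) (densityLaw q) x)
    (fun x => enorm_integral_le_lintegral_enorm _)
    (fun x => enorm_integral_le_lintegral_enorm _)
    (hG.measurable_lintegral_post hF.enorm)
    (hp.lintegral_post_sq_le hq hM hχ hσ hF.enorm hcp)
    -- The `q`-posterior mean is the same estimate with equal priors, whose divergence is `0`.
    (hq.lintegral_post_sq_le hq hM ((chiDiv_self two_ne_zero).trans_le zero_le) hσ
      hF.enorm hcq)).trans_eq ?_
  ring

lemma lintegral_score_sub_sq_le_sigma (hp : IsC1Density p) (hq : IsC1Density q) {M : ℝ≥0∞}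
    (hM : M ≠ ⊤) (hχ : chiDiv 2 q p ≤ M) (hσ : 0 < sigmaCoef f g s) :
    ∫⁻ x, ‖score (marginal f g p s) x - score (marginal f g q s) x‖ₑ ^ 2
      ∂densityLaw (marginal f g q s) ≤
    8 * (1 + M) * ENNReal.ofReal (32 * 2 ^ ((d : ℝ) / 2) * (1 / sigmaCoef f g s) ^ 2) := by
  simp_rw [hp.score_marginal_eq_integral_sub hσ, hq.score_marginal_eq_integral_sub hσ]
  have key : ∀ r : EuclideanSpace ℝ (Fin d) → ℝ, IsC1Density r →
      ∫⁻ z : EuclideanSpace ℝ (Fin d) × EuclideanSpace ℝ (Fin d),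
        ‖(sigmaCoef f g s ^ 2)⁻¹ • (alphaCoef f s • z.1 - z.2)‖ₑ ^ 4
        ∂jointLaw (gaussChannel d f g s) volume (densityLaw r) ≤
      ENNReal.ofReal (32 * 2 ^ ((d : ℝ) / 2) * (1 / sigmaCoef f g s) ^ 2) ^ 2 := by
    intro r hr
    have := hr.isProbabilityMeasure
    have hG := isChannel_gaussChannel (d := d) hσ
    rw [jointLaw, lintegral_withDensity_eq_lintegral_mul _ hG.measurable (by fun_prop),
      lintegral_prod _ (hG.measurable.mul (by fun_prop)).aemeasurable]
    calc _ ≤ ∫⁻ _, ENNReal.ofReal ((sigmaCoef f g s ^ 2)⁻¹ ^ 4 *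
          (32 * 2 ^ ((d : ℝ) / 2) * sigmaCoef f g s ^ 4)) ∂densityLaw r := by
          refine lintegral_mono fun x₀ => ?_
          rw [ENNReal.ofReal_mul (by positivity)]
          refine le_trans (le_of_eq ?_) (mul_le_mul' le_rfl
            (lintegral_norm_sub_pow_four_gaussDensity_le hσ (alphaCoef f s • x₀)))
          rw [← lintegral_const_mul' _ _ (by simp)]
          refine lintegral_congr fun x => ?_
          simp only [Pi.mul_apply, Function.uncurry_apply_pair, gaussChannel]
          rw [enorm_smul, mul_pow, Real.enorm_of_nonneg (by positivity),
            ← ENNReal.ofReal_pow (by positivity), ← enorm_neg (x - alphaCoef f s • x₀), neg_sub]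
          ring
      _ ≤ _ := by
          rw [lintegral_const, measure_univ, mul_one, ← ENNReal.ofReal_pow (by positivity)]
          refine ENNReal.ofReal_le_ofReal ?_
          have h1 : (1 : ℝ) ≤ 32 * 2 ^ ((d : ℝ) / 2) := by
            have : (1 : ℝ) ≤ 2 ^ ((d : ℝ) / 2) := Real.one_le_rpow (by norm_num) (by positivity)
            linarith
          calc _ = (32 * 2 ^ ((d : ℝ) / 2)) * (1 / sigmaCoef f g s) ^ 4 := by field_simp
            _ ≤ (32 * 2 ^ ((d : ℝ) / 2)) ^ 2 * (1 / sigmaCoef f g s) ^ 4 := by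
                gcongr
                exact le_self_pow₀ h1 two_ne_zero
            _ = _ := by ring
  exact hp.lintegral_sub_integral_post_sq_le hq hM hχ hσ
    (F := fun z => (sigmaCoef f g s ^ 2)⁻¹ • (alphaCoef f s • z.1 - z.2)) (by fun_prop)
    (key p hp) (key q hq)

/-- Isolating `x` from the posterior mean makes it cancel in the difference of two scores. The
posterior mean exists because the Gaussian factor makes `α x₀ - x` integrable. -/
lemma score_marginal_eq_integral_id (hp : IsC1Density p) (hσ : 0 < sigmaCoef f g s)
    (x : EuclideanSpace ℝ (Fin d)) :
    score (marginal f g p s) x = (sigmaCoef f g s ^ 2)⁻¹ •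
      (alphaCoef f s • ∫ x₀, x₀ ∂post (gaussChannel d f g s) (densityLaw p) x - x) := by
  have := hp.isProbabilityMeasure
  have := (isChannel_gaussChannel (d := d) hσ).isProbabilityMeasure_post (μ := densityLaw p) x
  have h1 : Integrable (fun x₀ => (sigmaCoef f g s ^ 2)⁻¹ • (alphaCoef f s • x₀ - x))
      (post (gaussChannel d f g s) (densityLaw p) x) := by
    rw [hp.integrable_post_iff hσ]
    refine ((hp.integrable_smul_sub hσ x).smul (marginal f g p s x)⁻¹).congr
      (ae_of_all _ fun x₀ => ?_)
    simp only [posterior, Pi.smul_apply, smul_smul]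
    congr 1
    ring
  have h2 : Integrable (fun x₀ => alphaCoef f s • x₀)
      (post (gaussChannel d f g s) (densityLaw p) x) := by
    refine ((h1.smul (sigmaCoef f g s ^ 2)).add (integrable_const x)).congr
      (ae_of_all _ fun x₀ => ?_)
    simp [smul_smul, hσ.ne']
  rw [hp.score_marginal_eq_integral_sub hσ, integral_smul, integral_sub h2 (integrable_const x),
    integral_smul]
  simp

lemma lintegral_score_sub_sq_le_alpha (hp : IsC1Density p) (hq : IsC1Density q) {M : ℝ≥0∞}
    (hM : M ≠ ⊤) (hχ : chiDiv 2 q p ≤ M)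
    (hMp : (∫⁻ x, ‖x‖ₑ ^ 4 * ENNReal.ofReal (p x)) ≤ M)
    (hMq : (∫⁻ x, ‖x‖ₑ ^ 4 * ENNReal.ofReal (q x)) ≤ M) (hσ : 0 < sigmaCoef f g s) :
    ∫⁻ x, ‖score (marginal f g p s) x - score (marginal f g q s) x‖ₑ ^ 2
      ∂densityLaw (marginal f g q s) ≤
    8 * (1 + M) ^ 2 * ENNReal.ofReal ((alphaCoef f s / sigmaCoef f g s ^ 2) ^ 2) := by
  have hα := alphaCoef_pos f s
  have := hp.isProbabilityMeasure
  have := hq.isProbabilityMeasure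
  have hG := isChannel_gaussChannel (d := d) hσ
  have hM1 : M ≤ (1 + M) ^ 2 := le_add_self.trans (le_self_pow₀ le_self_add two_ne_zero)
  have h : ∀ x, ‖score (marginal f g p s) x - score (marginal f g q s) x‖ₑ ^ 2 =
      ENNReal.ofReal ((alphaCoef f s / sigmaCoef f g s ^ 2) ^ 2) *
        ‖∫ x₀, x₀ ∂post (gaussChannel d f g s) (densityLaw p) x -
          ∫ x₀, x₀ ∂post (gaussChannel d f g s) (densityLaw q) x‖ₑ ^ 2 := by
    intro x
    rw [hp.score_marginal_eq_integral_id hσ, hq.score_marginal_eq_integral_id hσ, ← smul_sub,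
      sub_sub_sub_cancel_right, ← smul_sub, smul_smul, enorm_smul, mul_pow,
      Real.enorm_of_nonneg (by positivity), ENNReal.ofReal_pow (by positivity)]
    congr 3
    ring
  simp_rw [h]
  rw [lintegral_const_mul' _ _ (by simp), mul_comm]
  gcongr
  refine (hp.lintegral_sub_integral_post_sq_le hq hM hχ hσ (F := Prod.fst) (c := 1 + M)
    measurable_fst ?_ ?_).trans_eq (by ring)
  · rw [hG.lintegral_jointLaw_fst (F := fun x => ‖x‖ₑ ^ 4) (by fun_prop), hp.lintegral_densityLaw]
    exact hMp.trans hM1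
  · rw [hG.lintegral_jointLaw_fst (F := fun x => ‖x‖ₑ ^ 4) (by fun_prop), hq.lintegral_densityLaw]
    exact hMq.trans hM1

lemma lintegral_score_sub_sq_le_first (hp : IsC1Density p) (hq : IsC1Density q) {M : ℝ≥0∞}
    (hM : M ≠ ⊤) (hχ : chiDiv 2 q p ≤ M)
    (hMp : (∫⁻ x, ‖x‖ₑ ^ 4 * ENNReal.ofReal (p x)) ≤ M)
    (hMq : (∫⁻ x, ‖x‖ₑ ^ 4 * ENNReal.ofReal (q x)) ≤ M) (hσ : 0 < sigmaCoef f g s) :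
    ∫⁻ x, ‖score (marginal f g p s) x - score (marginal f g q s) x‖ₑ ^ 2
      ∂densityLaw (marginal f g q s) ≤
    8 * (1 + M) ^ 2 * ENNReal.ofReal (512 * 2 ^ ((d : ℝ) / 2)) *
      ENNReal.ofReal ((1 / sigmaCoef f g s - sigmaCoef f g s) ^ 2 + alphaCoef f s ^ 2) := by
  have hα := alphaCoef_pos f s
  have hd : (1 : ℝ) ≤ 2 ^ ((d : ℝ) / 2) := Real.one_le_rpow (by norm_num) (by positivity)
  -- In this range `1/σ² ≤ 4`, so `α²/σ⁴ ≤ 16 α²`. Outside it `σ` is far from `1`, so `1/σ² ≤ 16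
  -- (1/σ - σ)²`.
  by_cases h : 1 / 2 ≤ sigmaCoef f g s ∧ sigmaCoef f g s ≤ 2
  · refine (hp.lintegral_score_sub_sq_le_alpha hq hM hχ hMp hMq hσ).trans ?_
    rw [mul_assoc _ (ENNReal.ofReal _) (ENNReal.ofReal _), ← ENNReal.ofReal_mul (by positivity)]
    gcongr
    generalize sigmaCoef f g s = σ at *
    have h4 : alphaCoef f s / σ ^ 2 ≤ 4 * alphaCoef f s := by
      rw [div_le_iff₀ (by positivity)]
      have : 1 / 4 ≤ σ ^ 2 := by nlinarith [h.1]
      nlinarith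
    calc (alphaCoef f s / σ ^ 2) ^ 2 ≤ (4 * alphaCoef f s) ^ 2 := by gcongr
      _ = 16 * alphaCoef f s ^ 2 := by ring
      _ ≤ (512 * 2 ^ ((d : ℝ) / 2)) * alphaCoef f s ^ 2 := by gcongr; linarith
      _ ≤ _ := by gcongr; nlinarith [sq_nonneg (1 / σ - σ)]
  · refine (hp.lintegral_score_sub_sq_le_sigma hq hM hχ hσ).trans ?_
    rw [mul_assoc _ (ENNReal.ofReal _) (ENNReal.ofReal _), ← ENNReal.ofReal_mul (by positivity)]
    refine mul_le_mul' ?_ (ENNReal.ofReal_le_ofReal ?_)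
    · gcongr
      exact le_self_pow₀ le_self_add two_ne_zero
    · generalize sigmaCoef f g s = σ at *
      have h4 : (1 / σ) ^ 2 ≤ 16 * (1 / σ - σ) ^ 2 := by
        have h5 : (1 / σ) ^ 2 * (16 * (1 - σ ^ 2) ^ 2) = 16 * (1 / σ - σ) ^ 2 := by
          field_simp
        rw [← h5]
        refine le_mul_of_one_le_right (by positivity) ?_
        rcases not_and_or.1 h with h | h
        · have : σ < 1 / 2 := not_le.1 h
          have : σ ^ 2 ≤ 1 / 4 := by nlinarith
          nlinarith
        · have : 2 < σ := not_le.1 h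
          have : 4 ≤ σ ^ 2 := by nlinarith
          nlinarith
      calc 32 * 2 ^ ((d : ℝ) / 2) * (1 / σ) ^ 2
          ≤ 32 * 2 ^ ((d : ℝ) / 2) * (16 * (1 / σ - σ) ^ 2) := by gcongr
        _ = 512 * 2 ^ ((d : ℝ) / 2) * (1 / σ - σ) ^ 2 := by ring
        _ ≤ _ := by gcongr; nlinarith [sq_nonneg (alphaCoef f s)]

end IsC1Density

end SpecDiffusion

/-! ### The score gap in terms of the divergence of the data -/

namespace SpecDiffusion

variable {d : ℕ} {p q : EuclideanSpace ℝ (Fin d) → ℝ} {f g : ℝ → ℝ} {s : ℝ}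

namespace IsC1Density

lemma ofReal_marginal_div (hp : IsC1Density p) (hq : IsC1Density q)
    (hpq : ∀ᵐ x, p x = 0 → q x = 0) (hσ : 0 < sigmaCoef f g s) (x : EuclideanSpace ℝ (Fin d)) :
    ENNReal.ofReal (marginal f g q s x / marginal f g p s x) =
      ∫⁻ x₀, densityRatio q p x₀ ∂post (gaussChannel d f g s) (densityLaw p) x := by
  have := hp.isProbabilityMeasure
  have hm := hp.marginal_pos (f := f) (g := g) (s := s) hσ x
  rw [ENNReal.ofReal_div_of_pos hm, ← hq.mix_gaussChannel hσ, ← hp.densityLaw_withDensity hq hpq,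
    (isChannel_gaussChannel (d := d) hσ).mix_withDensity (hp.measurable_densityRatio hq),
    hp.mix_gaussChannel hσ]
  exact ENNReal.mul_div_cancel_right (by simpa using hm) (by simp)

lemma enorm_marginal_div_sub_one_le (hp : IsC1Density p) (hq : IsC1Density q)
    (hpq : ∀ᵐ x, p x = 0 → q x = 0) (hσ : 0 < sigmaCoef f g s) (x : EuclideanSpace ℝ (Fin d)) :
    ‖marginal f g q s x / marginal f g p s x - 1‖ₑ ≤
      ∫⁻ x₀, ratioDev q p x₀ ∂post (gaussChannel d f g s) (densityLaw p) x := by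
  have := hp.isProbabilityMeasure
  have := (isChannel_gaussChannel (d := d) hσ).isProbabilityMeasure_post (μ := densityLaw p) x
  have hu := hp.measurable_densityRatio hq
  have hr : 0 ≤ marginal f g q s x / marginal f g p s x :=
    div_nonneg (hq.marginal_pos hσ x).le (hp.marginal_pos hσ x).le
  have hR := hp.ofReal_marginal_div hq hpq hσ x
  generalize marginal f g q s x / marginal f g p s x = r at *
  have h1 : ENNReal.ofReal r ≤
      1 + ∫⁻ x₀, ratioDev q p x₀ ∂post (gaussChannel d f g s) (densityLaw p) x := by
    rw [hR]
    refine (lintegral_mono (densityRatio_le q p)).trans ?_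
    rw [lintegral_add_left measurable_const]
    simp
  have h2 : 1 ≤ ENNReal.ofReal r +
      ∫⁻ x₀, ratioDev q p x₀ ∂post (gaussChannel d f g s) (densityLaw p) x := by
    rw [hR, ← lintegral_add_left hu]
    calc (1 : ℝ≥0∞) = ∫⁻ _, 1 ∂post (gaussChannel d f g s) (densityLaw p) x := by simp
      _ ≤ _ := lintegral_mono (hp.one_le_densityRatio_add hq)
  generalize ∫⁻ x₀, ratioDev q p x₀ ∂post (gaussChannel d f g s) (densityLaw p) x = V at *
  rcases eq_or_ne V ⊤ with rfl | hV
  · exact le_top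
  lift V to ℝ≥0 using hV
  rw [Real.enorm_eq_ofReal_abs]
  refine ENNReal.ofReal_le_of_le_toReal (abs_le.2 ?_)
  rw [← ENNReal.toReal_le_toReal (by simp) (by simp), ENNReal.toReal_add (by simp) (by simp),
    ENNReal.toReal_ofReal hr] at h1 h2
  simp at h1 h2 ⊢
  constructor <;> linarith

lemma enorm_posterior_sub_le (hp : IsC1Density p) (hq : IsC1Density q)
    (hpq : ∀ᵐ x, p x = 0 → q x = 0) (hσ : 0 < sigmaCoef f g s)
    (x₀ x : EuclideanSpace ℝ (Fin d)) (hx₀ : q x₀ = 0 → p x₀ = 0) :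
    ‖posterior f g p s x₀ x - posterior f g q s x₀ x‖ₑ ≤
      (ratioDev p q x₀ *
          ∫⁻ x₀, densityRatio q p x₀ ∂post (gaussChannel d f g s) (densityLaw p) x +
        ∫⁻ x₀, ratioDev q p x₀ ∂post (gaussChannel d f g s) (densityLaw p) x) *
      ENNReal.ofReal (posterior f g q s x₀ x) := by
  have hmp := hp.marginal_pos (f := f) (g := g) (s := s) hσ x
  have hmq := hq.marginal_pos (f := f) (g := g) (s := s) hσ x
  set r := marginal f g q s x / marginal f g p s x with hr
  -- The Gaussian kernel cancels in the quotient of the posteriors, leaving `(p/q) r`, and `(p/q) r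
  -- - 1 = -(1 - p/q) r + (r - 1)`.
  have h : posterior f g p s x₀ x - posterior f g q s x₀ x =
      (-(1 - p x₀ / q x₀) * r + (r - 1)) * posterior f g q s x₀ x := by
    rw [hr, posterior, posterior]
    by_cases hq0 : q x₀ = 0
    · simp [hq0, hx₀ hq0]
    · field_simp
      ring
  rw [h, enorm_mul, Real.enorm_of_nonneg (hq.posterior_nonneg hσ x₀ x)]
  gcongr
  refine (enorm_add_le _ _).trans (add_le_add ?_ (hp.enorm_marginal_div_sub_one_le hq hpq hσ x))
  rw [enorm_mul, enorm_neg, Real.enorm_of_nonneg (div_nonneg hmq.le hmp.le),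
    hp.ofReal_marginal_div hq hpq hσ, ratioDev]

lemma lintegral_post (hp : IsC1Density p) (hσ : 0 < sigmaCoef f g s)
    (x : EuclideanSpace ℝ (Fin d)) (F : EuclideanSpace ℝ (Fin d) → ℝ≥0∞) :
    ∫⁻ x₀, F x₀ ∂post (gaussChannel d f g s) (densityLaw p) x =
      ∫⁻ x₀, F x₀ * ENNReal.ofReal (posterior f g p s x₀ x) := by
  rw [hp.post_gaussChannel hσ, densityLaw, lintegral_withDensity_eq_lintegral_mul_non_measurable _
    (hp.measurable_posterior x).ennreal_ofReal (by simp)]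
  simp [mul_comm]

/-- Inserting the `q`-posterior mean of `h` separates the change of posterior from the change of
integrand. -/
lemma enorm_integral_post_sub_le (hp : IsC1Density p) (hq : IsC1Density q)
    (hpq : ∀ᵐ x, p x = 0 → q x = 0) (hqp : ∀ᵐ x, q x = 0 → p x = 0) (hσ : 0 < sigmaCoef f g s)
    (x : EuclideanSpace ℝ (Fin d)) {h k : EuclideanSpace ℝ (Fin d) → EuclideanSpace ℝ (Fin d)}
    (hhp : Integrable h (post (gaussChannel d f g s) (densityLaw p) x))
    (hhq : Integrable h (post (gaussChannel d f g s) (densityLaw q) x))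
    (hkq : Integrable k (post (gaussChannel d f g s) (densityLaw q) x)) :
    ‖∫ x₀, h x₀ ∂post (gaussChannel d f g s) (densityLaw p) x -
        ∫ x₀, k x₀ ∂post (gaussChannel d f g s) (densityLaw q) x‖ₑ ≤
      ∫⁻ x₀, ‖h x₀‖ₑ * (ratioDev p q x₀ *
          ∫⁻ x₀, densityRatio q p x₀ ∂post (gaussChannel d f g s) (densityLaw p) x +
        ∫⁻ x₀, ratioDev q p x₀ ∂post (gaussChannel d f g s) (densityLaw p) x)
          ∂post (gaussChannel d f g s) (densityLaw q) x +
      ∫⁻ x₀, ‖h x₀ - k x₀‖ₑ ∂post (gaussChannel d f g s) (densityLaw q) x := by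
  rw [← sub_add_sub_cancel _ (∫ x₀, h x₀ ∂post (gaussChannel d f g s) (densityLaw q) x)]
  refine (enorm_add_le _ _).trans (add_le_add ?_ ?_)
  · rw [hp.integral_post hσ, hq.integral_post hσ, ← integral_sub
      ((hp.integrable_post_iff hσ x h).1 hhp) ((hq.integrable_post_iff hσ x h).1 hhq),
      hq.lintegral_post hσ]
    refine (enorm_integral_le_lintegral_enorm _).trans (lintegral_mono_ae ?_)
    filter_upwards [hqp] with x₀ hx₀
    rw [← sub_smul, enorm_smul, mul_assoc, mul_comm]
    gcongr
    exact hp.enorm_posterior_sub_le hq hpq hσ x₀ x hx₀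
  · rw [← integral_sub hhq hkq]
    exact enorm_integral_le_lintegral_enorm _

/-- Needed for `∇log p` under the `q`-posterior: a moment under `q` gives integrability for almost
every output. -/
lemma ae_integrable_post (hp : IsC1Density p) (hσ : 0 < sigmaCoef f g s)
    {h : EuclideanSpace ℝ (Fin d) → EuclideanSpace ℝ (Fin d)} (hh : Measurable h)
    (hfin : ∫⁻ x, ‖h x‖ₑ ^ 4 ∂densityLaw p ≠ ⊤) :
    ∀ᵐ x ∂densityLaw (marginal f g p s),
      Integrable h (post (gaussChannel d f g s) (densityLaw p) x) := by
  have := hp.isProbabilityMeasure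
  have hG := isChannel_gaussChannel (d := d) hσ
  have h1 := hG.lintegral_post_outLaw (μ := densityLaw p) hh.enorm
  rw [hp.outLaw_gaussChannel hσ] at h1
  have h2 : ∫⁻ x, ‖h x‖ₑ ∂densityLaw p ≠ ⊤ := fun htop => by
    have := lintegral_pow_le (μ := densityLaw p) hh.enorm.aemeasurable (k := 4) (by norm_num)
    rw [htop] at this
    simp at this
    exact hfin this
  rw [← h1] at h2
  filter_upwards [ae_lt_top (hG.measurable_lintegral_post (hh.enorm.comp measurable_fst)) h2]
    with x hx
  exact ⟨hh.aestronglyMeasurable, hx⟩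

lemma lintegral_post_sq_le_self (hq : IsC1Density q) (hσ : 0 < sigmaCoef f g s)
    {h : EuclideanSpace ℝ (Fin d) → ℝ≥0∞} (hh : Measurable h) :
    ∫⁻ x, (∫⁻ x₀, h x₀ ∂post (gaussChannel d f g s) (densityLaw q) x) ^ 2
      ∂densityLaw (marginal f g q s) ≤ ∫⁻ x, h x ^ 2 ∂densityLaw q := by
  have := hq.isProbabilityMeasure
  rw [← hq.outLaw_gaussChannel hσ]
  exact (isChannel_gaussChannel (d := d) hσ).lintegral_post_pow_outLaw_le_fst hh one_le_two

lemma lintegral_sq_le_of_pow_four (hq : IsC1Density q)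
    {h : EuclideanSpace ℝ (Fin d) → ℝ≥0∞} (hh : Measurable h) {M : ℝ≥0∞}
    (hM : ∫⁻ x, h x ^ 4 ∂densityLaw q ≤ M) : ∫⁻ x, h x ^ 2 ∂densityLaw q ≤ 1 + M := by
  have := hq.isProbabilityMeasure
  refine (ENNReal.pow_le_pow_left_iff two_ne_zero).1 ?_
  refine (lintegral_pow_le (hh.pow_const 2).aemeasurable one_le_two).trans ?_
  simp_rw [← pow_mul]
  exact hM.trans (le_add_self.trans (le_self_pow₀ le_self_add two_ne_zero))

/-- Bound on the gap between the posterior means of the scores when the densities are far apart. -/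
lemma lintegral_integral_score_sub_sq_le_of_one_le (hp : IsC1Density p) (hq : IsC1Density q)
    {M B : ℝ≥0∞} (hpq : ∀ᵐ x, p x = 0 → q x = 0) (hqp : ∀ᵐ x, q x = 0 → p x = 0)
    (hMp : ∫⁻ x, ‖score p x‖ₑ ^ 4 ∂densityLaw q ≤ M)
    (hMq : ∫⁻ x, ‖score q x‖ₑ ^ 4 ∂densityLaw q ≤ M)
    (h8 : chiDiv 8 p q ≤ M) (hB : chiDiv 16 q p ≤ B ^ 8) (hB1 : 1 ≤ B)
    (hσ : 0 < sigmaCoef f g s) :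
    ∫⁻ x, ‖∫ x₀, score p x₀ ∂post (gaussChannel d f g s) (densityLaw p) x -
        ∫ x₀, score q x₀ ∂post (gaussChannel d f g s) (densityLaw q) x‖ₑ ^ 2
      ∂densityLaw (marginal f g q s) ≤ 2 ^ 7 * (1 + M) * B := by
  have := hp.isProbabilityMeasure
  have := hq.isProbabilityMeasure
  have hG := isChannel_gaussChannel (d := d) hσ
  have hu := hp.measurable_densityRatio hq
  have hd := hp.densityLaw_withDensity hq hpq
  have : IsProbabilityMeasure ((densityLaw p).withDensity (densityRatio q p)) := by rwa [hd]
  have hQ : ∫⁻ x, (∫⁻ x₀, ‖score p x₀‖ₑ ∂post (gaussChannel d f g s) (densityLaw p) x) ^ 2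
      ∂densityLaw (marginal f g q s) ≤ 2 ^ 5 * (1 + M) * B := by
    have h := hG.pow_four_lintegral_post_sq_le (μ := densityLaw p) hu (measurable_score p).enorm
      (hq.measurable_densityRatio hp) (by rw [hd, hq.densityLaw_withDensity hp hqp])
    rw [hd, hq.outLaw_gaussChannel hσ] at h
    -- The power `B ^ 4` is what makes the final bound linear in `B` after the fourth root; Jensen
    -- passes from the fifth to the tenth moment, and `1 ≤ B ^ 8` absorbs the constant.
    have hu5 : ∫⁻ x, densityRatio q p x ^ 5 ∂densityLaw p ≤ 2 ^ 9 * B ^ 4 := by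
      refine (ENNReal.pow_le_pow_left_iff two_ne_zero).1 ?_
      refine (lintegral_pow_le (hu.pow_const 5).aemeasurable one_le_two).trans ?_
      simp_rw [← pow_mul]
      calc _ ≤ 2 ^ 16 * (1 + chiDiv 16 q p) :=
            hp.lintegral_densityRatio_pow_le hq hpq (by norm_num)
        _ ≤ 2 ^ 16 * (B ^ 8 + B ^ 8) := by
            gcongr
            exact one_le_pow₀ hB1
        _ = 2 ^ 17 * B ^ 8 := by ring
        _ ≤ 2 ^ 18 * B ^ 8 := by gcongr <;> norm_num
        _ = _ := by ring
    have hM2 : M ^ 2 * (1 + M) ≤ (1 + M) ^ 4 := by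
      calc _ ≤ (1 + M) ^ 2 * (1 + M) := by gcongr; exact le_add_self
        _ = (1 + M) ^ 3 := by ring
        _ ≤ _ := pow_le_pow_right₀ le_self_add (by norm_num)
    refine (ENNReal.pow_le_pow_left_iff four_ne_zero).1 (h.trans ?_)
    calc _ ≤ M ^ 2 * ((2 ^ 8 * (1 + chiDiv 8 p q)) * (2 ^ 9 * B ^ 4)) := by
          gcongr
          exact hq.lintegral_densityRatio_pow_le hp hqp (by norm_num)
      _ ≤ M ^ 2 * ((2 ^ 8 * (1 + M)) * (2 ^ 9 * B ^ 4)) := by gcongr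
      _ = 2 ^ 17 * (M ^ 2 * (1 + M)) * B ^ 4 := by ring
      _ ≤ 2 ^ 20 * (1 + M) ^ 4 * B ^ 4 := by gcongr <;> norm_num
      _ = _ := by ring
  have hQ' : ∫⁻ x, (∫⁻ x₀, ‖score q x₀‖ₑ ∂post (gaussChannel d f g s) (densityLaw q) x) ^ 2
      ∂densityLaw (marginal f g q s) ≤ (1 + M) * B :=
    (hq.lintegral_post_sq_le_self hσ (measurable_score q).enorm).trans
      ((hq.lintegral_sq_le_of_pow_four (measurable_score q).enorm hMq).trans
        (le_mul_of_one_le_right zero_le hB1))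
  calc _ ≤ 2 * (2 ^ 5 * (1 + M) * B + (1 + M) * B) :=
        lintegral_enorm_sub_sq_le
          (A := fun x => ∫⁻ x₀, ‖score p x₀‖ₑ ∂post (gaussChannel d f g s) (densityLaw p) x)
          (B := fun x => ∫⁻ x₀, ‖score q x₀‖ₑ ∂post (gaussChannel d f g s) (densityLaw q) x)
          (fun x => enorm_integral_le_lintegral_enorm _)
          (fun x => enorm_integral_le_lintegral_enorm _)
          (hG.measurable_lintegral_post ((measurable_score p).enorm.comp measurable_fst)) hQ hQ'
    _ = 66 * (1 + M) * B := by ring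
    _ ≤ _ := by gcongr; norm_num

/-- Bound on the gap between the posterior means of the scores when the densities are close. -/
lemma lintegral_integral_score_sub_sq_le_of_le_one (hp : IsC1Density p) (hq : IsC1Density q)
    {M A B : ℝ≥0∞} (hM : M ≠ ⊤)
    (hpq : ∀ᵐ x, p x = 0 → q x = 0) (hqp : ∀ᵐ x, q x = 0 → p x = 0)
    (hMp : ∫⁻ x, ‖score p x‖ₑ ^ 4 ∂densityLaw q ≤ M)
    (hMq : ∫⁻ x, ‖score q x‖ₑ ^ 4 ∂densityLaw q ≤ M)
    (hA : chiDiv 16 p q ≤ A ^ 8) (hB : chiDiv 16 q p ≤ B ^ 8) (hB1 : B ≤ 1)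
    (hσ : 0 < sigmaCoef f g s)
    (hint : ∀ x, Integrable (score p) (post (gaussChannel d f g s) (densityLaw p) x)) :
    ∫⁻ x, ‖∫ x₀, score p x₀ ∂post (gaussChannel d f g s) (densityLaw p) x -
        ∫ x₀, score q x₀ ∂post (gaussChannel d f g s) (densityLaw q) x‖ₑ ^ 2
      ∂densityLaw (marginal f g q s) ≤ 2 ^ 7 * (1 + M) * (fisherDiv q p + A + B) := by
  have := hp.isProbabilityMeasure
  have := hq.isProbabilityMeasure
  have hG := isChannel_gaussChannel (d := d) hσ
  have hu := hp.measurable_densityRatio hq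
  have hd := hp.densityLaw_withDensity hq hpq
  have hpd : IsProbabilityMeasure ((densityLaw p).withDensity (densityRatio q p)) := by rwa [hd]
  -- Because `B ≤ 1`, these moments have an absolute bound, and the smallness in `A + B` is kept for
  -- the perturbation terms.
  have hmoment : ∀ j ≤ 16, ∫⁻ x, densityRatio q p x ^ j ∂densityLaw p ≤ (2 ^ 9) ^ 2 := by
    intro j hj
    calc _ ≤ 2 ^ 16 * (1 + chiDiv 16 q p) := hp.lintegral_densityRatio_pow_le hq hpq hj
      _ ≤ 2 ^ 16 * (1 + 1) := by
          gcongr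
          exact hB.trans (pow_le_one₀ zero_le hB1)
      _ ≤ _ := by norm_num
  have hmean := hG.sq_lintegral_post_perturb_le (μ := densityLaw p) hu (A := A) (B := B)
    (measurable_score p).enorm (hq.measurable_ratioDev hp) (hp.measurable_ratioDev hq)
    (hmoment 9 (by norm_num)) (hmoment 2 (by norm_num))
    (by
      rw [hd]
      refine (ENNReal.pow_le_pow_left_iff two_ne_zero).1 ?_
      refine (hq.sq_lintegral_ratioDev_pow_le hp 8 hqp).trans (hA.trans_eq ?_)
      ring)
    (by
      refine (ENNReal.pow_le_pow_left_iff two_ne_zero).1 ?_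
      refine (hp.sq_lintegral_ratioDev_pow_le hq 8 hpq).trans (hB.trans_eq ?_)
      ring)
  rw [hd, hq.outLaw_gaussChannel hσ] at hmean
  set R : EuclideanSpace ℝ (Fin d) → ℝ≥0∞ := fun x =>
    ∫⁻ x₀, densityRatio q p x₀ ∂post (gaussChannel d f g s) (densityLaw p) x
  set V : EuclideanSpace ℝ (Fin d) → ℝ≥0∞ := fun x =>
    ∫⁻ x₀, ratioDev q p x₀ ∂post (gaussChannel d f g s) (densityLaw p) x
  have hR : Measurable R := hG.measurable_lintegral_post (hu.comp measurable_fst)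
  have hV : Measurable V :=
    hG.measurable_lintegral_post ((hp.measurable_ratioDev hq).comp measurable_fst)
  set W : EuclideanSpace ℝ (Fin d) → ℝ≥0∞ := fun x =>
    ∫⁻ x₀, ‖score p x₀‖ₑ * (ratioDev p q x₀ * R x + V x)
      ∂post (gaussChannel d f g s) (densityLaw q) x
  set U : EuclideanSpace ℝ (Fin d) → ℝ≥0∞ := fun x =>
    ∫⁻ x₀, ‖score p x₀ - score q x₀‖ₑ ∂post (gaussChannel d f g s) (densityLaw q) x
  have hsp := measurable_score p
  have hsq := measurable_score q
  have ht := hq.measurable_ratioDev hp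
  have hWm : Measurable W := hG.measurable_lintegral_post
    (F := fun z => ‖score p z.1‖ₑ * (ratioDev p q z.1 * R z.2 + V z.2)) (by fun_prop)
  have hW : ∫⁻ x, W x ^ 2 ∂densityLaw (marginal f g q s) ≤ 2 ^ 6 * (1 + M) * (A + B) := by
    refine (ENNReal.pow_le_pow_left_iff two_ne_zero).1 (hmean.trans ?_)
    calc _ ≤ 8 * 2 ^ 9 * M * (A + B) ^ 2 := by gcongr
      _ ≤ 8 * 2 ^ 9 * (1 + M) ^ 2 * (A + B) ^ 2 := by
          gcongr
          exact le_add_self.trans (le_self_pow₀ le_self_add two_ne_zero)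
      _ = _ := by ring
  have hU : ∫⁻ x, U x ^ 2 ∂densityLaw (marginal f g q s) ≤ fisherDiv q p := by
    refine (hq.lintegral_post_sq_le_self hσ (hsp.sub hsq).enorm).trans_eq ?_
    rw [hq.lintegral_densityLaw, fisherDiv]
    simp_rw [Pi.sub_apply, enorm_sub_rev (score p _)]
  calc _ ≤ ∫⁻ x, 2 * (W x ^ 2 + U x ^ 2) ∂densityLaw (marginal f g q s) := by
        refine lintegral_mono_ae ?_
        filter_upwards [hq.ae_integrable_post hσ hsp (hMp.trans_lt hM.lt_top).ne,
          hq.ae_integrable_post hσ hsq (hMq.trans_lt hM.lt_top).ne] with x hx1 hx2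
        exact (pow_le_pow_left' (hp.enorm_integral_post_sub_le hq hpq hqp hσ x (hint x) hx1 hx2)
          2).trans (add_sq_le_two_mul _ _)
    _ = 2 * (∫⁻ x, W x ^ 2 ∂densityLaw (marginal f g q s) +
          ∫⁻ x, U x ^ 2 ∂densityLaw (marginal f g q s)) := by
        rw [lintegral_const_mul' _ _ (by simp), lintegral_add_left (by fun_prop)]
    _ ≤ 2 * (2 ^ 6 * (1 + M) * (A + B) + fisherDiv q p) := by gcongr
    _ = 2 ^ 7 * (1 + M) * (A + B) + 2 * 1 * fisherDiv q p := by ring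
    _ ≤ 2 ^ 7 * (1 + M) * (A + B) + 2 ^ 7 * (1 + M) * fisherDiv q p := by
        gcongr
        · norm_num
        · exact le_self_add
    _ = _ := by ring

lemma lintegral_score_sub_sq_le_second (hp : IsC1Density p) (hq : IsC1Density q)
    {M : ℝ≥0∞} (hM : M ≠ ⊤) (hχ : chiDiv 2 q p ≤ M)
    (hMp : (∫⁻ x, ‖score p x‖ₑ ^ 4 * ENNReal.ofReal (q x)) ≤ M)
    (hMq : (∫⁻ x, ‖score q x‖ₑ ^ 4 * ENNReal.ofReal (q x)) ≤ M)
    (h8 : chiDiv 8 p q ≠ ⊤ → chiDiv 8 p q ≤ M) (hσ : 0 < sigmaCoef f g s)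
    (hip : ∀ x, Integrable (fun x₀ => ‖score p x₀‖ * posterior f g p s x₀ x))
    (hiq : ∀ x, Integrable (fun x₀ => ‖score q x₀‖ * posterior f g q s x₀ x)) :
    ∫⁻ x, ‖score (marginal f g p s) x - score (marginal f g q s) x‖ₑ ^ 2
      ∂densityLaw (marginal f g q s) ≤
    2 ^ 7 * (1 + M) * (dataDiv p q / ENNReal.ofReal (alphaCoef f s ^ 2)) := by
  have := hq.isProbabilityMeasure
  have hα := alphaCoef_pos f s
  have hα0 : ENNReal.ofReal (alphaCoef f s ^ 2) ≠ 0 := by simpa using hα.ne'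
  have hpq := hp.ae_eq_zero_of_chiDiv_ne_top hq (hχ.trans_lt hM.lt_top).ne
  rw [← hq.lintegral_densityLaw] at hMp hMq
  rw [← mul_div_assoc, ENNReal.le_div_iff_mul_le (Or.inl hα0) (Or.inl (by simp)), mul_comm,
    ← lintegral_const_mul' _ _ (by simp)]
  have hscore : ∀ x, ENNReal.ofReal (alphaCoef f s ^ 2) *
      ‖score (marginal f g p s) x - score (marginal f g q s) x‖ₑ ^ 2 =
      ‖∫ x₀, score p x₀ ∂post (gaussChannel d f g s) (densityLaw p) x -
        ∫ x₀, score q x₀ ∂post (gaussChannel d f g s) (densityLaw q) x‖ₑ ^ 2 := by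
    intro x
    rw [← hp.smul_score_marginal_eq_integral_score hσ hip,
      ← hq.smul_score_marginal_eq_integral_score hσ hiq, ← smul_sub, enorm_smul, mul_pow,
      Real.enorm_of_nonneg hα.le, ENNReal.ofReal_pow hα.le]
  simp_rw [hscore]
  -- An infinite divergence makes the right-hand side infinite. Otherwise `q` dominates `p`, and
  -- Jensen makes `χ₈(p|q)` finite, which activates `h8`.
  by_cases hA : chiDiv 16 p q = ⊤
  · rw [dataDiv, hA, ENNReal.top_rpow_of_pos (by norm_num), add_top, top_add, ENNReal.mul_top]
    · exact le_top
    · simp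
  have hqp := hq.ae_eq_zero_of_chiDiv_ne_top hp hA
  have hroot : ∀ y : ℝ≥0∞, y ≤ (y ^ (1 / 8 : ℝ)) ^ 8 := by
    intro y
    rw [← ENNReal.rpow_natCast, ← ENNReal.rpow_mul]
    norm_num
  have h8' : chiDiv 8 p q ≤ M := by
    refine h8 fun htop => hA ?_
    have h := hq.sq_lintegral_ratioDev_pow_le hp 8 hqp
    rw [hq.lintegral_ratioDev_pow hqp, htop] at h
    simpa using h
  -- Close densities use the perturbation estimate; for distant ones the last term of `dataDiv` is
  -- at least `1` and the triangle inequality is enough.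
  rcases le_total (chiDiv 16 q p ^ (1 / 8 : ℝ)) 1 with hB | hB
  · refine hp.lintegral_integral_score_sub_sq_le_of_le_one hq hM hpq hqp hMp hMq (hroot _)
      (hroot _) hB hσ fun x => ?_
    rw [hp.integrable_post_iff hσ]
    refine (hip x).mono ?_ (ae_of_all _ fun x₀ => ?_)
    · exact ((hp.measurable_posterior x).smul (measurable_score p)).aestronglyMeasurable
    · simp [norm_smul, mul_comm]
  · refine (hp.lintegral_integral_score_sub_sq_le_of_one_le hq hpq hqp hMp hMq h8' (hroot _)
      hB hσ).trans ?_
    gcongr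
    exact le_add_self

end IsC1Density

end SpecDiffusion

/-! ### Moments of the acceptance ratio -/

namespace SpecDiffusion

section Acceptance

variable {d : ℕ}

lemma gaussDensity_add_div (z v : EuclideanSpace ℝ (Fin d)) :
    gaussDensity 0 1 (z + v) / gaussDensity 0 1 z =
      Real.exp (-(inner ℝ z v + ‖v‖ ^ 2 / 2)) := by
  have hc : (0 : ℝ) < (2 * Real.pi * 1 ^ 2) ^ (-(d : ℝ) / 2) := by positivity
  rw [gaussDensity, gaussDensity, mul_div_mul_left _ _ hc.ne', ← Real.exp_sub, sub_zero, sub_zero,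
    norm_add_sq_real]
  ring_nf

/-- `⟪v, z⟫` is a centred real Gaussian of variance `‖v‖²`; its moment generating function at `-1`
is `exp (‖v‖² / 2)`. -/
lemma integral_exp_neg_inner_stdGaussian (v : EuclideanSpace ℝ (Fin d)) :
    ∫ z, Real.exp (-(inner ℝ z v + ‖v‖ ^ 2 / 2)) ∂stdGaussian (EuclideanSpace ℝ (Fin d)) = 1 := by
  have h := IsGaussian.map_eq_gaussianReal (μ := stdGaussian (EuclideanSpace ℝ (Fin d)))
    (innerSL ℝ v)
  rw [integral_strongDual_stdGaussian, variance_dual_stdGaussian, innerSL_apply_norm] at h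
  have hm := mgf_gaussianReal h (-1)
  rw [mgf] at hm
  have : ∀ z : EuclideanSpace ℝ (Fin d), Real.exp (-(inner ℝ z v + ‖v‖ ^ 2 / 2)) =
      Real.exp (-1 * innerSL ℝ v z) * Real.exp (-(‖v‖ ^ 2 / 2)) := by
    intro z
    rw [← Real.exp_add, innerSL_apply_apply, real_inner_comm]
    ring_nf
  simp_rw [this]
  rw [integral_mul_const, hm, ← Real.exp_add, Real.coe_toNNReal _ (by positivity)]
  simp

variable {ν : Measure (EuclideanSpace ℝ (Fin d))}
  {D : EuclideanSpace ℝ (Fin d) → EuclideanSpace ℝ (Fin d)}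

lemma integrable_inner_prod (hD : Integrable D ν) :
    Integrable (fun w : EuclideanSpace ℝ (Fin d) × EuclideanSpace ℝ (Fin d) =>
      (inner ℝ w.2 (D w.1) : ℝ)) (ν.prod (stdGaussian _)) := by
  have hZ : Integrable (fun z => z) (stdGaussian (EuclideanSpace ℝ (Fin d))) :=
    IsGaussian.integrable_id
  refine (hD.norm.mul_prod hZ.norm).mono ?_ (ae_of_all _ fun w => ?_)
  · exact (continuous_snd.aestronglyMeasurable).inner hD.aestronglyMeasurable.comp_fst
  · rw [norm_mul, norm_norm, norm_norm, mul_comm]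
    exact norm_inner_le_norm _ _

variable [IsProbabilityMeasure ν]

lemma integrable_exp_neg_inner_prod (hD : Measurable D) :
    Integrable (fun w : EuclideanSpace ℝ (Fin d) × EuclideanSpace ℝ (Fin d) =>
      Real.exp (-(inner ℝ w.2 (D w.1) + ‖D w.1‖ ^ 2 / 2))) (ν.prod (stdGaussian _)) := by
  rw [integrable_prod_iff (Measurable.aestronglyMeasurable (by fun_prop))]
  constructor
  · refine ae_of_all _ fun y => Integrable.of_integral_ne_zero ?_
    exact (integral_exp_neg_inner_stdGaussian (D y)).trans_ne one_ne_zero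
  · simp_rw [Real.norm_of_nonneg (Real.exp_pos _).le, integral_exp_neg_inner_stdGaussian]
    exact integrable_const _

lemma integral_exp_neg_inner_prod (hD : Measurable D) :
    ∫ w : EuclideanSpace ℝ (Fin d) × EuclideanSpace ℝ (Fin d),
      Real.exp (-(inner ℝ w.2 (D w.1) + ‖D w.1‖ ^ 2 / 2)) ∂(ν.prod (stdGaussian _)) = 1 := by
  rw [integral_prod _ (integrable_exp_neg_inner_prod hD)]
  simp_rw [integral_exp_neg_inner_stdGaussian]
  simp

lemma integral_inner_prod (hD : Integrable D ν) :
    ∫ w : EuclideanSpace ℝ (Fin d) × EuclideanSpace ℝ (Fin d),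
      (inner ℝ w.2 (D w.1) : ℝ) ∂(ν.prod (stdGaussian _)) = 0 := by
  rw [integral_prod _ (integrable_inner_prod hD)]
  refine (integral_congr_ae (ae_of_all _ fun y => ?_)).trans (integral_zero _ _)
  have h := integral_strongDual_stdGaussian (E := EuclideanSpace ℝ (Fin d)) (innerSL ℝ (D y))
  simp_rw [innerSL_apply_apply, real_inner_comm] at h
  exact h

end Acceptance

variable {d : ℕ} {f g : ℝ → ℝ} {s ε γ : ℝ} {p q : EuclideanSpace ℝ (Fin d) → ℝ}

lemma meanGap_eq (y : EuclideanSpace ℝ (Fin d)) :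
    meanGap f g ε γ p q s y = ((stepStd g ε γ s)⁻¹ * (γ * ((1 + ε ^ 2) / 2 * g s ^ 2))) •
      (score (marginal f g p s) y - score (marginal f g q s) y) := by
  rw [meanGap, stepMean, stepMean, backwardDrift, backwardDrift, add_sub_add_left_eq_sub,
    ← smul_sub, add_sub_add_left_eq_sub, ← smul_sub, smul_smul, smul_smul, mul_assoc]

/-- If `g s = 0`, the inverse of `0` is `0` and both sides vanish, in agreement with the convention
`Δ = 0`. -/
lemma stepStd_inv_mul_sq (hε : 0 < ε) (hγ : 0 < γ) :
    ((stepStd g ε γ s)⁻¹ * (γ * ((1 + ε ^ 2) / 2 * g s ^ 2))) ^ 2 =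
      γ * g s ^ 2 * (ε + 1 / ε) ^ 2 / 4 := by
  by_cases hg : g s = 0
  · simp [hg]
  · rw [mul_pow, inv_pow, stepStd, mul_pow, mul_pow, Real.sq_sqrt hγ.le]
    field_simp
    ring

lemma measurable_meanGap : Measurable (meanGap f g ε γ p q s) := by
  rw [funext (meanGap_eq (f := f) (g := g) (ε := ε) (γ := γ) (p := p) (q := q) (s := s))]
  exact ((measurable_score (marginal f g p s)).sub (measurable_score (marginal f g q s))).const_smul
    ((stepStd g ε γ s)⁻¹ * (γ * ((1 + ε ^ 2) / 2 * g s ^ 2)))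

lemma acceptRatio_eq (y z : EuclideanSpace ℝ (Fin d)) :
    acceptRatio f g ε γ p q s y z =
      Real.exp (-(inner ℝ z (meanGap f g ε γ p q s y) + ‖meanGap f g ε γ p q s y‖ ^ 2 / 2)) :=
  gaussDensity_add_div _ _

/-- Constant of the bound on the gap between the scores of the output laws. -/
noncomputable def scoreGapConst (d : ℕ) (M : ℝ≥0) : ℝ≥0 :=
  8 * (1 + M) ^ 2 * (512 * 2 ^ ((d : ℝ) / 2) : ℝ).toNNReal + 2 ^ 7 * (1 + M)

lemma lintegral_score_sub_sq_le {M : ℝ≥0} (hp : IsC1Density p) (hq : IsC1Density q)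
    (hMp : (∫⁻ x, ‖x‖ₑ ^ 4 * ENNReal.ofReal (p x)) ≤ M)
    (hMq : (∫⁻ x, ‖x‖ₑ ^ 4 * ENNReal.ofReal (q x)) ≤ M)
    (hSp : (∫⁻ x, ‖score p x‖ₑ ^ 4 * ENNReal.ofReal (q x)) ≤ M)
    (hSq : (∫⁻ x, ‖score q x‖ₑ ^ 4 * ENNReal.ofReal (q x)) ≤ M)
    (hχ : chiDiv 2 q p ≤ M)
    (h8 : chiDiv 8 p q ≠ ⊤ → chiDiv 8 p q ≤ M) (hσ : 0 < sigmaCoef f g s)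
    (hip : ∀ x, Integrable (fun x₀ => ‖score p x₀‖ * posterior f g p s x₀ x))
    (hiq : ∀ x, Integrable (fun x₀ => ‖score q x₀‖ * posterior f g q s x₀ x)) :
    ∫⁻ x, ‖score (marginal f g p s) x - score (marginal f g q s) x‖ₑ ^ 2
      ∂densityLaw (marginal f g q s) ≤
    ENNReal.ofReal (scoreGapConst d M * minFactor f g p q s) := by
  -- The first entry is finite, so `toReal` in `minFactor` loses nothing even when `dataDiv` is
  -- infinite.
  have hm : min (ENNReal.ofReal ((1 / sigmaCoef f g s - sigmaCoef f g s) ^ 2 + alphaCoef f s ^ 2))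
      (dataDiv p q / ENNReal.ofReal (alphaCoef f s ^ 2)) ≠ ⊤ :=
    ((min_le_left _ _).trans_lt ENNReal.ofReal_lt_top).ne
  rw [ENNReal.ofReal_mul (by positivity), minFactor, ENNReal.ofReal_toReal hm,
    ENNReal.ofReal_coe_nnreal, mul_min, le_min_iff]
  constructor
  · refine (hp.lintegral_score_sub_sq_le_first hq ENNReal.coe_ne_top hχ hMp hMq hσ).trans ?_
    gcongr
    rw [scoreGapConst]
    push_cast
    exact le_self_add
  · refine (hp.lintegral_score_sub_sq_le_second hq ENNReal.coe_ne_top hχ hSp hSq h8 hσ hip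
      hiq).trans ?_
    gcongr
    rw [scoreGapConst]
    push_cast
    exact le_add_self

end SpecDiffusion

/-! ### The main theorem -/

open SpecDiffusion

theorem mainTheorem2 (d : ℕ) (M : ℝ≥0) :
    ∃ C : ℝ, 0 ≤ C ∧
      ∀ (p q : EuclideanSpace ℝ (Fin d) → ℝ),
        SpecDiffusion.IsC1Density p → SpecDiffusion.IsC1Density q →
        (∫⁻ x, ‖x‖ₑ ^ 4 * ENNReal.ofReal (p x)) ≤ M →
        (∫⁻ x, ‖x‖ₑ ^ 4 * ENNReal.ofReal (q x)) ≤ M →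
        (∫⁻ x, ‖SpecDiffusion.score p x‖ₑ ^ 4 * ENNReal.ofReal (q x)) ≤ M →
        (∫⁻ x, ‖SpecDiffusion.score q x‖ₑ ^ 4 * ENNReal.ofReal (q x)) ≤ M →
        SpecDiffusion.chiDiv 2 q p ≤ M →
        (SpecDiffusion.chiDiv 8 p q ≠ ⊤ → SpecDiffusion.chiDiv 8 p q ≤ M) →
      ∀ (f g : ℝ → ℝ) (ε : ℝ) (N n : ℕ) (γ s : ℝ),
        0 < ε → n < N → γ = 1 / (N : ℝ) → s = 1 - (n : ℝ) * γ →
        ContinuousOn f (Set.Icc 0 s) → ContinuousOn g (Set.Icc 0 s) →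
        0 < SpecDiffusion.sigmaCoef f g s →
        (∀ x, Integrable
          (fun x₀ => ‖SpecDiffusion.score p x₀‖ * SpecDiffusion.posterior f g p s x₀ x)) →
        (∀ x, Integrable
          (fun x₀ => ‖SpecDiffusion.score q x₀‖ * SpecDiffusion.posterior f g q s x₀ x)) →
      ∀ {Ω : Type*} [MeasurableSpace Ω] (P : Measure Ω) (Y Z : Ω → EuclideanSpace ℝ (Fin d)),
        HasLaw Y (volume.withDensity
          (fun x => ENNReal.ofReal (SpecDiffusion.marginal f g q s x))) P →
        HasLaw Z (stdGaussian (EuclideanSpace ℝ (Fin d))) P →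
        IndepFun Y Z P →
        Integrable (fun ω => Real.log (SpecDiffusion.acceptRatio f g ε γ p q s (Y ω) (Z ω))) P ∧
        -(C * γ * g s ^ 2 * (ε + 1 / ε) ^ 2 * SpecDiffusion.minFactor f g p q s) ≤
          ∫ ω, Real.log (SpecDiffusion.acceptRatio f g ε γ p q s (Y ω) (Z ω)) ∂P ∧
        Integrable (fun ω => SpecDiffusion.acceptRatio f g ε γ p q s (Y ω) (Z ω)) P ∧
        Real.exp
            (-(C * γ * g s ^ 2 * (ε + 1 / ε) ^ 2 * SpecDiffusion.minFactor f g p q s)) ≤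
          ∫ ω, SpecDiffusion.acceptRatio f g ε γ p q s (Y ω) (Z ω) ∂P := by
  -- The factor `1/8` is `1/4` from the squared coefficient of the score gap in `Δ` times `1/2` from
  -- `E[log a] = -E‖Δ‖² / 2`.
  refine ⟨scoreGapConst d M / 8, by positivity, ?_⟩
  intro p q hp hq hMp hMq hSp hSq hχ h8 f g ε N n γ s hε hn hγ hs _ _ hσ hip hiq Ω _ P Y Z hY hZ
    hYZ
  have hN : (0 : ℝ) < N := by exact_mod_cast (Nat.zero_le n).trans_lt hn
  have hγ0 : 0 < γ := by rw [hγ]; positivity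
  have : IsProbabilityMeasure P := hZ.isProbabilityMeasure
  have : IsProbabilityMeasure (densityLaw (marginal f g q s)) :=
    hY.isProbabilityMeasure_iff.1 inferInstance
  have hlaw : HasLaw (fun ω => (Y ω, Z ω)) ((densityLaw (marginal f g q s)).prod
      (stdGaussian (EuclideanSpace ℝ (Fin d)))) P := hYZ.hasLaw_prod hY hZ
  have hmin : 0 ≤ minFactor f g p q s := ENNReal.toReal_nonneg
  have hB : 0 ≤ scoreGapConst d M / 8 * γ * g s ^ 2 * (ε + 1 / ε) ^ 2 * minFactor f g p q s := by
    positivity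
  set D := meanGap f g ε γ p q s with hDdef
  have hD : Measurable D := measurable_meanGap
  have hD2 : ∫⁻ y, ‖D y‖ₑ ^ 2 ∂densityLaw (marginal f g q s) ≤
      ENNReal.ofReal (γ * g s ^ 2 * (ε + 1 / ε) ^ 2 / 4 *
        (scoreGapConst d M * minFactor f g p q s)) := by
    rw [ENNReal.ofReal_mul (by positivity)]
    refine le_trans (le_of_eq ?_) (mul_le_mul' le_rfl
      (lintegral_score_sub_sq_le hp hq hMp hMq hSp hSq hχ h8 hσ hip hiq))
    rw [← lintegral_const_mul' _ _ (by simp)]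
    refine lintegral_congr fun y => ?_
    rw [hDdef, meanGap_eq, enorm_smul, mul_pow, ← stepStd_inv_mul_sq hε hγ0, ← enorm_pow,
      Real.enorm_of_nonneg (sq_nonneg _)]
  -- Square integrability makes `log a` integrable, which allows the centred term `⟪Z, Δ⟫` to be
  -- integrated away.
  have hDL : MemLp D 2 (densityLaw (marginal f g q s)) := by
    refine ⟨hD.aestronglyMeasurable, ?_⟩
    rw [eLpNorm_lt_top_iff_lintegral_rpow_enorm_lt_top two_ne_zero ENNReal.ofNat_ne_top]
    simpa using hD2.trans_lt ENNReal.ofReal_lt_top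
  have hDi : Integrable D (densityLaw (marginal f g q s)) := hDL.integrable one_le_two
  have hDs : Integrable (fun y => ‖D y‖ ^ 2 / 2) (densityLaw (marginal f g q s)) :=
    (hDL.integrable_norm_pow two_ne_zero).div_const 2
  have hDint : ∫ y, ‖D y‖ ^ 2 / 2 ∂densityLaw (marginal f g q s) ≤
      scoreGapConst d M / 8 * γ * g s ^ 2 * (ε + 1 / ε) ^ 2 * minFactor f g p q s := by
    rw [integral_div, integral_eq_lintegral_of_nonneg_ae (ae_of_all _ fun y => sq_nonneg _)
      (hD.norm.pow_const 2).aestronglyMeasurable]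
    have h := ENNReal.toReal_mono ENNReal.ofReal_ne_top hD2
    rw [ENNReal.toReal_ofReal (by positivity)] at h
    simp_rw [ENNReal.ofReal_pow (norm_nonneg _), ofReal_norm]
    linarith
  have hlogint : Integrable (fun w : EuclideanSpace ℝ (Fin d) × EuclideanSpace ℝ (Fin d) =>
      -(inner ℝ w.2 (D w.1) + ‖D w.1‖ ^ 2 / 2))
      ((densityLaw (marginal f g q s)).prod (stdGaussian _)) :=
    ((integrable_inner_prod hDi).add (hDs.comp_fst _)).neg
  have hexpint := integrable_exp_neg_inner_prod (ν := densityLaw (marginal f g q s)) hD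
  have hlog : ∀ ω, Real.log (acceptRatio f g ε γ p q s (Y ω) (Z ω)) =
      -(inner ℝ (Z ω) (D (Y ω)) + ‖D (Y ω)‖ ^ 2 / 2) := fun ω => by
    rw [acceptRatio_eq, Real.log_exp]
  simp_rw [hlog, acceptRatio_eq]
  refine ⟨?_, ?_, ?_, ?_⟩
  · rw [← hlaw.map_eq] at hlogint
    exact hlogint.comp_aemeasurable hlaw.aemeasurable
  · have h := hlaw.integral_comp hlogint.aestronglyMeasurable
    rw [Function.comp_def] at h
    rw [h, integral_neg, integral_add (integrable_inner_prod hDi) (hDs.comp_fst _),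
      integral_inner_prod hDi, integral_fun_fst (fun y => ‖D y‖ ^ 2 / 2)]
    simpa using hDint
  · rw [← hlaw.map_eq] at hexpint
    exact hexpint.comp_aemeasurable hlaw.aemeasurable
  · have h := hlaw.integral_comp hexpint.aestronglyMeasurable
    rw [Function.comp_def] at h
    -- The expectation is exactly `1`, so only the sign of the exponent remains.
    rw [h, integral_exp_neg_inner_prod hD]
    exact Real.exp_le_one_iff.2 (neg_nonpos.2 hB)
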